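/- Conventions. Latin indices run over $1,\dots,n$ and Greek indices over $1,\dots,n-1$; repeated indices are summed; everything is smooth. A Finsler space $F^n=(M^n,L)$ is an $n$-dimensional manifold $M^n$ ($n\ge 1$) with a function $L(x,y)>0$ defined for the supporting elements $(x,y)$ in an open set $D$ of nonzero tangent vectors that is stable under $y\mapsto ty$, $t>0$ ($D$ may be all nonzero tangent vectors), positively homogeneous of degree one in $y$, whose metric tensor $g_{ij}=\frac12\dot\partial_i\dot\partial_jL^2$ is nondegenerate, where $\dot\partial_i=\partial/\partial y^i$. Put $l_i=\dot\partial_iL$, $h_{ij}=g_{ij}-l_il_j$, $C_{ijk}=\frac12\dot\partial_ig_{jk}$, $C^h_{ij}=g^{hr}C_{rij}$, and let $(F^i_{jk},N^i_j,C^i_{jk})$ be the Cartan connection: $N^i_j=\dot\partial_jG^i$ with $G^i=\frac14g^{ir}(y^k\partial_k\dot\partial_rL^2-\partial_rL^2)$, and $F^i_{jk}=\frac12g^{ir}(\delta_jg_{rk}+\delta_kg_{jr}-\delta_rg_{jk})$ with $\delta_j=\partial_j-N^r_j\dot\partial_r$, $\partial_j=\partial/\partial x^j$. For a covector field $X_i(x,y)$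 put $X_{i|j}=\delta_jX_i-X_rF^r_{ij}$ and $X_i|_j=\dot\partial_jX_i-X_rC^r_{ij}$. An $h$-vector is a covector field $b_i(x,y)$ on $D$ with $b_i|_k=0$ and $L\,C^h_{ij}b_h=\rho\,h_{ij}$ for a scalar function $\rho$ that is not identically zero. It is a gradient if $b_{i|j}=b_{j|i}$. Given an $h$-vector, let ${}^*F^n=(M^n,{}^*L)$ with ${}^*L=L\,e^{\beta/L}$, $\beta=b_iy^i$, and suppose that it is again a Finsler space on $D$. Let $M^{n-1}$ be an immersed hypersurface of $M^n$, locally $x^i=x^i(u)$, with $B^i_\alpha=\partial x^i/\partial u^\alpha$, $B^i_{\alpha\beta}=\partial^2x^i/\partial u^\alpha\partial u^\beta$. At a supporting element $(u,v)$ with $(x(u),y)\in D$, $y^i=B^i_\alpha v^\alpha$, a unit normal $N^i$ of $F^{n-1}$ satisfies $g_{ij}B^i_\alpha N^j=0$ and $g_{ij}N^iN^j=1$. Assume that a unit normal of $F^{n-1}$ and one of ${}^*F^{n-1}$ (defined with ${}^*L$ in place of $L$) exist at each such $(u,v)$. Put $N_i=g_{ij}N^j$ and $$M_\alpha=C_{ijk}B^i_\alpha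 N^jN^k,\qquad M_{\alpha\beta}=C_{ijk}B^i_\alpha B^j_\beta N^k,\qquad H_\alpha=N_i\bigl(B^i_{\beta\alpha}v^\beta+N^i_jB^j_\alpha\bigr),$$ $$H_{\alpha\beta}=N_i\bigl(B^i_{\alpha\beta}+F^i_{jk}B^j_\alpha B^k_\beta\bigr)+M_\alpha H_\beta .$$ $F^{n-1}$ is a hyperplane of the second kind if $H_{\alpha\beta}=0$ at all such $(u,v)$, and of the third kind if $H_{\alpha\beta}=0=M_{\alpha\beta}$ at all such $(u,v)$. The same definitions with ${}^*L$ in place of $L$ apply to ${}^*F^{n-1}$. Theorem. Suppose that the $h$-vector $b_i$ is a gradient, is tangential to $F^{n-1}$ (that is, $b_iN^i=0$ at all such $(u,v)$), and satisfies $b_{r|0}\,C^r_{ij}=\kappa\,h_{ij}$ on $D$ for some scalar function $\kappa$, where $b_{r|0}=b_{r|k}y^k$. Then: (1) ${}^*F^{n-1}$ is a hyperplane of the second kind if $F^{n-1}$ is a hyperplane of the second kind and $M_{\alpha\beta}=0$; (2) ${}^*F^{n-1}$ is a hyperplane of the third kind if $F^{n-1}$ is a hyperplane of the third kind. -/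

import Mathlib

open scoped Manifold ContDiff

namespace Finsler

/-- The coordinate space `ℝⁿ`. -/
abbrev Coord (n : ℕ) := EuclideanSpace ℝ (Fin n)

/-- The standard model with corners on `ℝⁿ`. -/
noncomputable abbrev Mod (n : ℕ) := 𝓘(ℝ, Coord n)

/-- The `i`-th coordinate vector. -/
noncomputable abbrev basisVec {n : ℕ} (i : Fin n) : Coord n := EuclideanSpace.single i (1 : ℝ)

section Local

/-!
Local expressions. A point `z = (x, y)` consists of a position `x` and a supporting element `y`;
`L` is a fundamental function in coordinates.
-/

/-- `∂_j f = ∂f/∂x^j`. -/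
noncomputable def dX {n : ℕ} (j : Fin n) (f : Coord n × Coord n → ℝ) (z : Coord n × Coord n) : ℝ :=
  fderiv ℝ f z (basisVec j, 0)

/-- The vertical derivative `∂f/∂y^j`. -/
noncomputable def dY {n : ℕ} (j : Fin n) (f : Coord n × Coord n → ℝ) (z : Coord n × Coord n) : ℝ :=
  fderiv ℝ f z (0, basisVec j)

/-- Metric tensor `g_ij = ½ ∂²L²/∂y^i∂y^j`, as a matrix. -/
noncomputable def metric {n : ℕ} (L : Coord n × Coord n → ℝ) (z : Coord n × Coord n) :
    Matrix (Fin n) (Fin n) ℝ :=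
  Matrix.of fun i j => (1 / 2 : ℝ) * dY i (dY j fun w => L w ^ 2) z

/-- Inverse metric `g^ij`. -/
noncomputable def metricInv {n : ℕ} (L : Coord n × Coord n → ℝ) (z : Coord n × Coord n) :
    Matrix (Fin n) (Fin n) ℝ :=
  (metric L z)⁻¹

/-- Angular metric tensor `h_ij = g_ij - l_i l_j`, where `l_i = ∂L/∂y^i`. -/
noncomputable def angular {n : ℕ} (L : Coord n × Coord n → ℝ) (i j : Fin n)
    (z : Coord n × Coord n) : ℝ :=
  metric L z i j - dY i L z * dY j L z

/-- Cartan tensor `C_ijk = ½ ∂g_jk/∂y^i`. -/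
noncomputable def cartan {n : ℕ} (L : Coord n × Coord n → ℝ) (i j k : Fin n)
    (z : Coord n × Coord n) : ℝ :=
  (1 / 2 : ℝ) * dY i (fun w => metric L w j k) z

/-- `C^h_ij = g^hr C_rij`. -/
noncomputable def cartanUp {n : ℕ} (L : Coord n × Coord n → ℝ) (h i j : Fin n)
    (z : Coord n × Coord n) : ℝ :=
  ∑ r, metricInv L z h r * cartan L r i j z

/-- Spray coefficients `G^i = ¼ g^ir (y^k ∂²L²/∂x^k∂y^r - ∂L²/∂x^r)`. -/
noncomputable def spray {n : ℕ} (L : Coord n × Coord n → ℝ) (i : Fin n)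
    (z : Coord n × Coord n) : ℝ :=
  (1 / 4 : ℝ) * ∑ r, metricInv L z i r *
    (∑ k, z.2 k * dX k (dY r fun w => L w ^ 2) z - dX r (fun w => L w ^ 2) z)

/-- Nonlinear part of the Cartan connection, `N^i_j = ∂G^i/∂y^j` (also written `G^i_j`). -/
noncomputable def nonlin {n : ℕ} (L : Coord n × Coord n → ℝ) (i j : Fin n)
    (z : Coord n × Coord n) : ℝ :=
  dY j (spray L i) z

/-- Horizontal derivative `δ_j f = ∂_j f - N^r_j ∂f/∂y^r`. -/
noncomputable def delta {n : ℕ} (L : Coord n × Coord n → ℝ) (j : Fin n)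
    (f : Coord n × Coord n → ℝ) (z : Coord n × Coord n) : ℝ :=
  dX j f z - ∑ r, nonlin L r j z * dY r f z

/-- Horizontal coefficients of the Cartan connection,
`F^i_jk = ½ g^ir (δ_j g_rk + δ_k g_jr - δ_r g_jk)`. -/
noncomputable def cartanF {n : ℕ} (L : Coord n × Coord n → ℝ) (i j k : Fin n)
    (z : Coord n × Coord n) : ℝ :=
  (1 / 2 : ℝ) * ∑ r, metricInv L z i r *
    (delta L j (fun w => metric L w r k) z + delta L k (fun w => metric L w j r) z
      - delta L r (fun w => metric L w j k) z)

/-- `h`-covariant derivative `X_{i|j} = ∂_j X_i - N^r_j ∂X_i/∂y^r - X_r F^r_ij`. -/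
noncomputable def hCov {n : ℕ} (L : Coord n × Coord n → ℝ) (X : Fin n → Coord n × Coord n → ℝ)
    (i j : Fin n) (z : Coord n × Coord n) : ℝ :=
  delta L j (X i) z - ∑ r, X r z * cartanF L r i j z

/-- `v`-covariant derivative `X_i|_j = ∂X_i/∂y^j - X_r C^r_ij`. -/
noncomputable def vCov {n : ℕ} (L : Coord n × Coord n → ℝ) (X : Fin n → Coord n × Coord n → ℝ)
    (i j : Fin n) (z : Coord n × Coord n) : ℝ :=
  dY j (X i) z - ∑ r, X r z * cartanUp L r i j z

/-- `L` is a fundamental function on the set `D` of supporting elements: `D` is open, consists of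
nonzero vectors and is stable under positive scaling; on `D` the function `L` is smooth, positive,
positively homogeneous of degree one, and has nondegenerate metric tensor. -/
structure IsFundamental {n : ℕ} (D : Set (Coord n × Coord n)) (L : Coord n × Coord n → ℝ) :
    Prop where
  isOpen : IsOpen D
  ne_zero : ∀ z ∈ D, z.2 ≠ 0
  conic : ∀ z ∈ D, ∀ t : ℝ, 0 < t → (z.1, t • z.2) ∈ D
  smooth : ContDiffOn ℝ ∞ L D
  pos : ∀ z ∈ D, 0 < L z
  homogeneous : ∀ z ∈ D, ∀ t : ℝ, 0 < t → L (z.1, t • z.2) = t * L z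
  regular : ∀ z ∈ D, (metric L z).det ≠ 0

/-!
Hypersurfaces: `p` is a local parametrization `u ↦ x(u)`, and `(u, v)` is a supporting element.
-/

/-- Projection factors `B^i_α = ∂x^i/∂u^α`. -/
noncomputable def proj {n m : ℕ} (p : Coord m → Coord n) (i : Fin n) (a : Fin m)
    (u : Coord m) : ℝ :=
  fderiv ℝ p u (basisVec a) i

/-- `B^i_αβ = ∂²x^i/∂u^α∂u^β`. -/
noncomputable def proj2 {n m : ℕ} (p : Coord m → Coord n) (i : Fin n) (a b : Fin m)
    (u : Coord m) : ℝ :=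
  fderiv ℝ (proj p i a) u (basisVec b)

/-- The point `(x(u), y)` with `y^i = B^i_α v^α`. -/
noncomputable def lift {n m : ℕ} (p : Coord m → Coord n) (u v : Coord m) : Coord n × Coord n :=
  (p u, fderiv ℝ p u v)

/-- `N` is a unit normal at `(u, v)`: `g_ij B^i_α N^j = 0` and `g_ij N^i N^j = 1`. -/
def IsUnitNormal {n m : ℕ} (L : Coord n × Coord n → ℝ) (p : Coord m → Coord n) (u v : Coord m)
    (N : Fin n → ℝ) : Prop :=
  (∀ a, ∑ i, ∑ j, metric L (lift p u v) i j * proj p i a u * N j = 0) ∧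
    ∑ i, ∑ j, metric L (lift p u v) i j * N i * N j = 1

/-- `N_i = g_ij N^j`. -/
noncomputable def conormal {n m : ℕ} (L : Coord n × Coord n → ℝ) (p : Coord m → Coord n)
    (u v : Coord m) (N : Fin n → ℝ) (i : Fin n) : ℝ :=
  ∑ j, metric L (lift p u v) i j * N j

/-- `M_α = C_ijk B^i_α N^j N^k`. -/
noncomputable def vecM {n m : ℕ} (L : Coord n × Coord n → ℝ) (p : Coord m → Coord n)
    (u v : Coord m) (N : Fin n → ℝ) (a : Fin m) : ℝ :=
  ∑ i, ∑ j, ∑ k, cartan L i j k (lift p u v) * proj p i a u * N j * N k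

/-- Second fundamental `v`-tensor `M_αβ = C_ijk B^i_α B^j_β N^k`. -/
noncomputable def tenM {n m : ℕ} (L : Coord n × Coord n → ℝ) (p : Coord m → Coord n)
    (u v : Coord m) (N : Fin n → ℝ) (a b : Fin m) : ℝ :=
  ∑ i, ∑ j, ∑ k, cartan L i j k (lift p u v) * proj p i a u * proj p j b u * N k

/-- Normal curvature vector `H_α = N_i (B^i_0α + N^i_j B^j_α)`, where `B^i_0α = B^i_βα v^β`. -/
noncomputable def vecH {n m : ℕ} (L : Coord n × Coord n → ℝ) (p : Coord m → Coord n)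
    (u v : Coord m) (N : Fin n → ℝ) (a : Fin m) : ℝ :=
  ∑ i, conormal L p u v N i *
    (∑ b, proj2 p i b a u * v b + ∑ j, nonlin L i j (lift p u v) * proj p j a u)

/-- Second fundamental `h`-tensor
`H_αβ = N_i (B^i_αβ + F^i_jk B^j_α B^k_β) + M_α H_β`. -/
noncomputable def tenH {n m : ℕ} (L : Coord n × Coord n → ℝ) (p : Coord m → Coord n)
    (u v : Coord m) (N : Fin n → ℝ) (a b : Fin m) : ℝ :=
  ∑ i, conormal L p u v N i *
      (proj2 p i a b u +
        ∑ j, ∑ k, cartanF L i j k (lift p u v) * proj p j a u * proj p k b u)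
    + vecM L p u v N a * vecH L p u v N b

end Local

section Global

variable {n : ℕ} {M : Type*} [TopologicalSpace M] [ChartedSpace (Coord n) M]

/-- The tangent vector of `M` whose coordinates in the chart `φ` are `z = (x, y)`. -/
noncomputable def vecOf (φ : OpenPartialHomeomorph M (Coord n)) (z : Coord n × Coord n) :
    TangentBundle (Mod n) M :=
  ⟨φ.symm z.1, mfderiv (Mod n) (Mod n) φ.symm z.1 z.2⟩

/-- Coordinate expression of a set of tangent vectors. -/
def localDom (D : Set (TangentBundle (Mod n) M)) (φ : OpenPartialHomeomorph M (Coord n)) :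
    Set (Coord n × Coord n) :=
  {z | z.1 ∈ φ.target ∧ vecOf φ z ∈ D}

/-- Coordinate expression of a function of tangent vectors. -/
noncomputable def localFun (f : TangentBundle (Mod n) M → ℝ)
    (φ : OpenPartialHomeomorph M (Coord n)) (z : Coord n × Coord n) : ℝ :=
  f (vecOf φ z)

/-- Components `b_i(x, y)`, in the chart `φ`, of a field `b` of covectors that depends on the
supporting element. -/
noncomputable def localCovec
    (b : (w : TangentBundle (Mod n) M) → TangentSpace (Mod n) w.proj →L[ℝ] ℝ)
    (φ : OpenPartialHomeomorph M (Coord n)) (i : Fin n) (z : Coord n × Coord n) : ℝ :=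
  b (vecOf φ z) (mfderiv (Mod n) (Mod n) φ.symm z.1 (basisVec i))

/-- `(M, L)` is a Finsler space, with `D` the set of admissible supporting elements. The set `D`
may be all nonzero tangent vectors or only a conic open part of them. -/
def IsFinslerSpace (D : Set (TangentBundle (Mod n) M)) (L : TangentBundle (Mod n) M → ℝ) : Prop :=
  ∀ φ ∈ IsManifold.maximalAtlas (Mod n) ∞ M, IsFundamental (localDom D φ) (localFun L φ)

/-- `b` is an `h`-vector of `(M, L)`: it is smooth, `b_i|_k = 0` and `L C^h_ij b_h = ρ h_ij` for
some scalar function `ρ` that is not the zero function. -/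
def IsHVector (D : Set (TangentBundle (Mod n) M)) (L : TangentBundle (Mod n) M → ℝ)
    (b : (w : TangentBundle (Mod n) M) → TangentSpace (Mod n) w.proj →L[ℝ] ℝ) : Prop :=
  ∃ ρ : TangentBundle (Mod n) M → ℝ, (∃ w ∈ D, ρ w ≠ 0) ∧
    ∀ φ ∈ IsManifold.maximalAtlas (Mod n) ∞ M,
      (∀ i, ContDiffOn ℝ ∞ (localCovec b φ i) (localDom D φ)) ∧
      ∀ z ∈ localDom D φ, ∀ i j,
        vCov (localFun L φ) (localCovec b φ) i j z = 0 ∧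
        localFun L φ z * ∑ h, cartanUp (localFun L φ) h i j z * localCovec b φ h z
          = localFun ρ φ z * angular (localFun L φ) i j z

/-- `b` is a gradient: `b_{i|j} = b_{j|i}`. -/
def IsGradient (D : Set (TangentBundle (Mod n) M)) (L : TangentBundle (Mod n) M → ℝ)
    (b : (w : TangentBundle (Mod n) M) → TangentSpace (Mod n) w.proj →L[ℝ] ℝ) : Prop :=
  ∀ φ ∈ IsManifold.maximalAtlas (Mod n) ∞ M, ∀ z ∈ localDom D φ, ∀ i j,
    hCov (localFun L φ) (localCovec b φ) i j z = hCov (localFun L φ) (localCovec b φ) j i z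

/-- `b_{r|0} C^r_ij = κ h_ij` for some scalar function `κ`, where `b_{r|0} = b_{r|k} y^k`. -/
def HasKappa (D : Set (TangentBundle (Mod n) M)) (L : TangentBundle (Mod n) M → ℝ)
    (b : (w : TangentBundle (Mod n) M) → TangentSpace (Mod n) w.proj →L[ℝ] ℝ) : Prop :=
  ∃ κ : TangentBundle (Mod n) M → ℝ,
    ∀ φ ∈ IsManifold.maximalAtlas (Mod n) ∞ M, ∀ z ∈ localDom D φ, ∀ i j,
      ∑ r, (∑ k, hCov (localFun L φ) (localCovec b φ) r k z * z.2 k) *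
          cartanUp (localFun L φ) r i j z
        = localFun κ φ z * angular (localFun L φ) i j z

/-- The exponential change `L e^{β/L}` with `β = b_i y^i`. -/
noncomputable def expChange (L : TangentBundle (Mod n) M → ℝ)
    (b : (w : TangentBundle (Mod n) M) → TangentSpace (Mod n) w.proj →L[ℝ] ℝ)
    (w : TangentBundle (Mod n) M) : ℝ :=
  L w * Real.exp (b w w.snd / L w)

end Global

section Hypersurface

variable {m : ℕ} {M : Type*} [TopologicalSpace M] [ChartedSpace (Coord (m + 1)) M]
  {S : Type*} [TopologicalSpace S] [ChartedSpace (Coord m) S]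

/-- Local parametrization `x^i = x^i(u)` of the hypersurface `ι : S → M`. -/
def param (ι : S → M) (φ : OpenPartialHomeomorph M (Coord (m + 1)))
    (ψ : OpenPartialHomeomorph S (Coord m)) (u : Coord m) : Coord (m + 1) :=
  φ (ι (ψ.symm u))

/-- `P φ p u v N` holds for all charts `φ` of `M` and `ψ` of `S`, all supporting elements
`(u, v)` of `S` in these charts for which `y = B v` is admissible, and all unit normals `N` there;
`p` is the expression of `ι` in the charts. -/
def ForallNormal (D : Set (TangentBundle (Mod (m + 1)) M)) (L : TangentBundle (Mod (m + 1)) M → ℝ)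
    (ι : S → M)
    (P : OpenPartialHomeomorph M (Coord (m + 1)) → (Coord m → Coord (m + 1)) → Coord m → Coord m →
      (Fin (m + 1) → ℝ) → Prop) : Prop :=
  ∀ φ ∈ IsManifold.maximalAtlas (Mod (m + 1)) ∞ M, ∀ ψ ∈ IsManifold.maximalAtlas (Mod m) ∞ S,
    ∀ u ∈ ψ.target, ι (ψ.symm u) ∈ φ.source →
      ∀ v : Coord m, lift (param ι φ ψ) u v ∈ localDom D φ →
        ∀ N : Fin (m + 1) → ℝ, IsUnitNormal (localFun L φ) (param ι φ ψ) u v N →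
          P φ (param ι φ ψ) u v N

/-- `ι : S → M` is a Finslerian hypersurface of `(M, L)`: a smooth immersion,
with a unit normal at every tangent supporting element that is admissible. -/
structure IsFinslerHypersurface (D : Set (TangentBundle (Mod (m + 1)) M))
    (L : TangentBundle (Mod (m + 1)) M → ℝ) (ι : S → M) : Prop where
  smooth : ContMDiff (Mod m) (Mod (m + 1)) ∞ ι
  immersion : ∀ s, Function.Injective (mfderiv (Mod m) (Mod (m + 1)) ι s)
  unitNormal : ∀ φ ∈ IsManifold.maximalAtlas (Mod (m + 1)) ∞ M,
    ∀ ψ ∈ IsManifold.maximalAtlas (Mod m) ∞ S,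
      ∀ u ∈ ψ.target, ι (ψ.symm u) ∈ φ.source →
        ∀ v : Coord m, lift (param ι φ ψ) u v ∈ localDom D φ →
          ∃ N : Fin (m + 1) → ℝ, IsUnitNormal (localFun L φ) (param ι φ ψ) u v N

/-- `b` is tangential to the hypersurface: `b_j N^j = 0`. -/
def IsTangential (D : Set (TangentBundle (Mod (m + 1)) M)) (L : TangentBundle (Mod (m + 1)) M → ℝ)
    (b : (w : TangentBundle (Mod (m + 1)) M) → TangentSpace (Mod (m + 1)) w.proj →L[ℝ] ℝ)
    (ι : S → M) : Prop :=
  ForallNormal D L ι fun φ p u v N => ∑ j, localCovec b φ j (lift p u v) * N j = 0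

/-- `M_αβ = 0`. -/
def VanishingM (D : Set (TangentBundle (Mod (m + 1)) M)) (L : TangentBundle (Mod (m + 1)) M → ℝ)
    (ι : S → M) : Prop :=
  ForallNormal D L ι fun φ p u v N => ∀ a b, tenM (localFun L φ) p u v N a b = 0

/-- Hyperplane of the second kind: `H_αβ = 0`. -/
def IsHyperplaneSecondKind (D : Set (TangentBundle (Mod (m + 1)) M))
    (L : TangentBundle (Mod (m + 1)) M → ℝ)
    (ι : S → M) : Prop :=
  ForallNormal D L ι fun φ p u v N => ∀ a b, tenH (localFun L φ) p u v N a b = 0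

/-- Hyperplane of the third kind: `H_αβ = 0 = M_αβ`. -/
def IsHyperplaneThirdKind (D : Set (TangentBundle (Mod (m + 1)) M))
    (L : TangentBundle (Mod (m + 1)) M → ℝ)
    (ι : S → M) : Prop :=
  ForallNormal D L ι fun φ p u v N => ∀ a b,
    tenH (localFun L φ) p u v N a b = 0 ∧ tenM (localFun L φ) p u v N a b = 0

end Hypersurface

end Finsler

/-!
The proof avoids tensor components: with the energy `E = ½ L²`, the metric tensor, the Cartan tensor
and the connections are values of the iterated derivatives of `E` and of the spray `G`, and all
identities are differentiations of `E'(0, y) = 2E` and of the equation that defines `G`.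

Differentiating `δ_w E = 0` twice in vertical directions shows that the horizontal Berwald derivative
of `g` is the totally symmetric tensor `y_r G^r_ijk`, the Landsberg tensor
(`IsSpray.metric_horizontal`), and hence that the Cartan and Berwald connections differ by it
(`IsSpray.koszul`). For a hypersurface this turns the conditions into conditions on the spray and on
the direction of the normal `N` alone. `H_αβ = 0` everywhere means that the hypersurface is totally
geodesic and that the Landsberg tensor vanishes on `(B_α, B_β, N)`
(`IsNormalField.of_curvature_eq_zero`). Differentiating `g(N, B_β) = 0` along the hypersurface, the
latter means that the direction of `N` is parallel in the Berwald connection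
(`IsNormalField.landsberg_eq`), and `M_αβ = 0` means that the direction of `N` has zero derivative
in `v`, the supporting element (`IsNormalField.hasZeroCartan_iff`).

For `*L = L e^τ`, `τ = β/L`, the `h`-vector condition gives `∂β/∂y^i = b_i`, and tangentiality gives
`τ'(0, N) = 0`; it follows that `L` and `*L` have the same normal directions
(`IsGradientChange.isNormalField`). The gradient condition is the Euler–Lagrange equation for `β`
along the spray, so that the difference `Δ` of the sprays satisfies
`2 *g(Δ, w) = S(τ) (2 *E'(0, w) - e^{2τ} E'(0, w))`, where `S` is the spray vector field
(`IsGradientChange.spray_sub`). As the normal direction is parallel along the spray, `S(τ)` has no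
normal derivative (`IsGradientChange.fderiv_spray_ratio_normal`). Therefore `Δ` is tangent, and
`Δ'(0, N)` and `Δ''(0, N)(0, B_α)` are multiples of `N`: the direction of the normal is also parallel
in the Berwald connection of `*L` (`hyperplane_transfer`), and the equivalences above, read for
`*L`, give the theorem.
-/

namespace Finsler

/-! ### Fréchet derivatives and sprays -/

section Calculus

variable {X V F : Type*} [NormedAddCommGroup X] [NormedSpace ℝ X]
  [NormedAddCommGroup V] [NormedSpace ℝ V] [NormedAddCommGroup F] [NormedSpace ℝ F]

/-- The second Fréchet derivative, `d2 f z h k = D²f(z)(h, k)`. -/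
noncomputable abbrev d2 (f : V → F) : V → V →L[ℝ] V →L[ℝ] F := fderiv ℝ (fderiv ℝ f)

/-- The third Fréchet derivative, `d3 f z h k l = D³f(z)(h, k, l)`. -/
noncomputable abbrev d3 (f : V → F) : V → V →L[ℝ] V →L[ℝ] V →L[ℝ] F := fderiv ℝ (d2 f)

theorem hasFDerivAt_of_smooth {f : V → F} {z : V} (h : ContDiffAt ℝ ∞ f z) :
    HasFDerivAt f (fderiv ℝ f z) z :=
  (h.differentiableAt (by simp)).hasFDerivAt

theorem smooth_fderiv {f : V → F} {z : V} (h : ContDiffAt ℝ ∞ f z) :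
    ContDiffAt ℝ ∞ (fderiv ℝ f) z :=
  h.fderiv_right (by simp)

theorem hasFDerivAt_fderiv {f : V → F} {z : V} (h : ContDiffAt ℝ ∞ f z) :
    HasFDerivAt (fderiv ℝ f) (d2 f z) z :=
  hasFDerivAt_of_smooth (smooth_fderiv h)

theorem hasFDerivAt_d2 {f : V → F} {z : V} (h : ContDiffAt ℝ ∞ f z) :
    HasFDerivAt (d2 f) (d3 f z) z :=
  hasFDerivAt_fderiv (smooth_fderiv h)

theorem two_le_infty : (2 : WithTop ℕ∞) ≤ ∞ :=
  WithTop.coe_le_coe.2 (le_top : (2 : ℕ∞) ≤ ⊤)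

theorem d2_symm {f : V → F} {z : V} (h : ContDiffAt ℝ ∞ f z) (a b : V) :
    d2 f z a b = d2 f z b a :=
  (h.isSymmSndFDerivAt (by simpa using two_le_infty)).eq a b

theorem d3_symm_left {f : V → F} {z : V} (h : ContDiffAt ℝ ∞ f z) (a b c : V) :
    d3 f z a b c = d3 f z b a c := by
  have := d2_symm (smooth_fderiv h) a b
  exact congrArg (fun T => T c) this

/-- Two functions that agree near a point have the same directional derivatives there. -/
theorem hasFDerivAt_apply_eq {f g : X → F} {f' g' : X →L[ℝ] F} {q : X}
    (hf : HasFDerivAt f f' q) (hg : HasFDerivAt g g' q) (h : ∀ᶠ x in nhds q, f x = g x) (k : X) :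
    f' k = g' k := by
  rw [hf.unique (hg.congr_of_eventuallyEq h)]

theorem d3_symm_right {f : V → F} {z : V} (h : ContDiffAt ℝ ∞ f z) (a b c : V) :
    d3 f z a b c = d3 f z a c b := by
  have h1 : ∀ b c : V, HasFDerivAt (fun x => d2 f x b c)
      (((d3 f z).flip b).flip c) z := fun b c => by
    have := ((hasFDerivAt_d2 h).clm_apply (hasFDerivAt_const b z)).clm_apply
      (hasFDerivAt_const c z)
    convert this using 1
    ext x; simp
  have h2 : ∀ᶠ x in nhds z, d2 f x b c = d2 f x c b := by
    filter_upwards [(h.of_le two_le_infty).eventually (by simp)] with x hx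
    exact (hx.isSymmSndFDerivAt (by simp)).eq b c
  simpa using hasFDerivAt_apply_eq (h1 b c) (h1 c b) h2 a

end Calculus

section Spray

variable {V : Type*} [NormedAddCommGroup V] [NormedSpace ℝ V]

theorem vert_add {V : Type*} [AddCommGroup V] (a b : V) : ((0 : V), a + b) = (0, a) + (0, b) := by simp

theorem vert_sub {V : Type*} [AddCommGroup V] (a b : V) : ((0 : V), a - b) = (0, a) - (0, b) := by simp

theorem vert_neg {V : Type*} [AddCommGroup V] (a : V) : ((0 : V), -a) = -(0, a) := by simp

theorem vert_smul (c : ℝ) (a : V) : ((0 : V), c • a) = c • (0, a) := by simp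

theorem pair_eq {V : Type*} [AddCommGroup V] (a b : V) : (a, b) = (a, 0) + (0, b) := by simp

/-- `E` is the energy `½ L²` of a fundamental function on the set `D` of supporting elements
`z = (x, y)`, and `G` is its spray. The metric tensor is `g(a, b) = d2 E z (0, a) (0, b)`. The field
`euler` is the homogeneity of `E` of degree two in `y`. -/
structure IsSpray (D : Set (V × V)) (E : V × V → ℝ) (G : V × V → V) : Prop where
  isOpen : IsOpen D
  smoothE : ∀ z ∈ D, ContDiffAt ℝ ∞ E z
  smoothG : ∀ z ∈ D, ContDiffAt ℝ ∞ G z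
  euler : ∀ z ∈ D, fderiv ℝ E z (0, z.2) = 2 * E z
  nondegenerate : ∀ z ∈ D, ∀ x, (∀ w, d2 E z (0, x) (0, w) = 0) → x = 0
  spray : ∀ z ∈ D, ∀ w,
    2 * d2 E z (0, G z) (0, w) = d2 E z (z.2, 0) (0, w) - fderiv ℝ E z (w, 0)

/-- The Landsberg tensor (up to a factor): the covector `E'(0, ·)` applied to the third vertical
derivatives of the spray. -/
noncomputable def landsberg (E : V × V → ℝ) (G : V × V → V) (z : V × V) (a b c : V) : ℝ :=
  fderiv ℝ E z (0, d3 G z (0, a) (0, b) (0, c))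

namespace IsSpray

variable {D : Set (V × V)} {E : V × V → ℝ} {G : V × V → V}

theorem eventually_mem (h : IsSpray D E G) {z : V × V} (hz : z ∈ D) : ∀ᶠ x in nhds z, x ∈ D :=
  h.isOpen.mem_nhds hz

theorem euler_deriv (h : IsSpray D E G) {z : V × V} (hz : z ∈ D) (k : V × V) :
    d2 E z k (0, z.2) + fderiv ℝ E z (0, k.2) = 2 * fderiv ℝ E z k := by
  have h1 := (hasFDerivAt_fderiv (h.smoothE z hz)).clm_apply
    ((hasFDerivAt_const (0 : V) z).prodMk (hasFDerivAt_snd (𝕜 := ℝ) (p := z)))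
  have h2 := (hasFDerivAt_of_smooth (h.smoothE z hz)).const_mul 2
  have := hasFDerivAt_apply_eq h1 h2 ((h.eventually_mem hz).mono fun x hx => h.euler x hx) k
  simp at this
  linarith

theorem euler_deriv2 (h : IsSpray D E G) {z : V × V} (hz : z ∈ D) (k l : V × V) :
    d3 E z k l (0, z.2) + d2 E z l (0, k.2) + d2 E z k (0, l.2) = 2 * d2 E z k l := by
  have h0 := hasFDerivAt_fderiv (h.smoothE z hz)
  have h1 := (((hasFDerivAt_d2 (h.smoothE z hz)).clm_apply (hasFDerivAt_const l z)).clm_apply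
    ((hasFDerivAt_const (0 : V) z).prodMk (hasFDerivAt_snd (𝕜 := ℝ) (p := z)))).add
    (h0.clm_apply (hasFDerivAt_const ((0 : V), l.2) z))
  have h2 := (h0.clm_apply (hasFDerivAt_const l z)).const_mul 2
  have := hasFDerivAt_apply_eq h1 h2 ((h.eventually_mem hz).mono fun x hx => h.euler_deriv hx l) k
  simp at this
  linarith

theorem metric_self (h : IsSpray D E G) {z : V × V} (hz : z ∈ D) (w : V) :
    d2 E z (0, w) (0, z.2) = fderiv ℝ E z (0, w) := by
  have := h.euler_deriv hz (0, w)
  simp only at this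
  linarith

theorem cartan_self (h : IsSpray D E G) {z : V × V} (hz : z ∈ D) (a b : V) :
    d3 E z (0, a) (0, b) (0, z.2) = 0 := by
  have := h.euler_deriv2 hz (0, a) (0, b)
  simp only at this
  rw [d2_symm (h.smoothE z hz) (0, b)] at this
  linarith

/-- The derivative of the equation that defines the spray. -/
theorem spray_deriv (h : IsSpray D E G) {z : V × V} (hz : z ∈ D) (k : V × V) (w : V) :
    2 * (d3 E z k (0, G z) (0, w) + d2 E z (0, fderiv ℝ G z k) (0, w)) =
      d3 E z k (z.2, 0) (0, w) + d2 E z (k.2, 0) (0, w) - d2 E z k (w, 0) := by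
  have h0 := hasFDerivAt_fderiv (h.smoothE z hz)
  have h2 := hasFDerivAt_d2 (h.smoothE z hz)
  have hl := ((h2.clm_apply ((hasFDerivAt_const (0 : V) z).prodMk
    (hasFDerivAt_of_smooth (h.smoothG z hz)))).clm_apply
    (hasFDerivAt_const ((0 : V), w) z)).const_mul 2
  have hr := ((h2.clm_apply ((hasFDerivAt_snd (𝕜 := ℝ) (p := z)).prodMk
    (hasFDerivAt_const (0 : V) z))).clm_apply (hasFDerivAt_const ((0 : V), w) z)).sub
    (h0.clm_apply (hasFDerivAt_const (w, (0 : V)) z))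
  have := hasFDerivAt_apply_eq hl hr ((h.eventually_mem hz).mono fun x hx => h.spray x hx w) k
  simp at this
  linarith

/-- The spray is homogeneous of degree two. -/
theorem fderiv_spray_self (h : IsSpray D E G) {z : V × V} (hz : z ∈ D) :
    fderiv ℝ G z (0, z.2) = (2 : ℝ) • G z := by
  refine sub_eq_zero.1 (h.nondegenerate z hz _ fun w => ?_)
  have h1 := h.spray_deriv hz (0, z.2) w
  have h2 := h.spray z hz w
  have h3 := h.euler_deriv hz (w, 0)
  have h4 := h.euler_deriv2 hz (z.2, 0) (0, w)
  have h5 := h.cartan_self hz (G z) w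
  have hs := h.smoothE z hz
  rw [d3_symm_left hs, d3_symm_right hs, h5, d3_symm_left hs, d3_symm_right hs] at h1
  rw [d2_symm hs (0, z.2) (w, 0)] at h1
  have e0 : ((0 : V), (0 : V)) = 0 := rfl
  simp only [e0, map_zero] at h3 h4
  rw [vert_sub, vert_smul]
  simp only [map_sub, map_smul, sub_apply, smul_apply,
    smul_eq_mul]
  linarith

theorem d2_spray_self (h : IsSpray D E G) {z : V × V} (hz : z ∈ D) (k : V × V) :
    d2 G z k (0, z.2) + fderiv ℝ G z (0, k.2) = (2 : ℝ) • fderiv ℝ G z k := by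
  have h1 := (hasFDerivAt_fderiv (h.smoothG z hz)).clm_apply
    ((hasFDerivAt_const (0 : V) z).prodMk (hasFDerivAt_snd (𝕜 := ℝ) (p := z)))
  have h2 := (hasFDerivAt_of_smooth (h.smoothG z hz)).const_smul (2 : ℝ)
  have := hasFDerivAt_apply_eq h1 h2
    ((h.eventually_mem hz).mono fun x hx => h.fderiv_spray_self hx) k
  simp at this
  rw [← this, add_comm]

theorem d2_spray_vert_self (h : IsSpray D E G) {z : V × V} (hz : z ∈ D) (a : V) :
    d2 G z (0, a) (0, z.2) = fderiv ℝ G z (0, a) := by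
  have := h.d2_spray_self hz (0, a)
  simp only [two_smul] at this
  exact add_right_cancel this

theorem d3_spray_self (h : IsSpray D E G) {z : V × V} (hz : z ∈ D) (a b : V) :
    d3 G z (0, a) (0, b) (0, z.2) = 0 := by
  have h0 := hasFDerivAt_fderiv (h.smoothG z hz)
  have h1 := (((hasFDerivAt_d2 (h.smoothG z hz)).clm_apply
    (hasFDerivAt_const ((0 : V), b) z)).clm_apply
    ((hasFDerivAt_const (0 : V) z).prodMk (hasFDerivAt_snd (𝕜 := ℝ) (p := z))))
  have h2 := h0.clm_apply (hasFDerivAt_const ((0 : V), b) z)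
  have := hasFDerivAt_apply_eq h1 h2
    ((h.eventually_mem hz).mono fun x hx => h.d2_spray_vert_self hx b) (0, a)
  simp at this
  rw [d2_symm (h.smoothG z hz)] at this
  simpa using this

/-- The energy is constant along the spray. -/
theorem energy_spray (h : IsSpray D E G) {z : V × V} (hz : z ∈ D) :
    fderiv ℝ E z (z.2, (-2 : ℝ) • G z) = 0 := by
  have h1 := h.spray z hz z.2
  have h2 := h.metric_self hz (G z)
  have h3 := h.euler_deriv hz (z.2, 0)
  have e0 : ((0 : V), (0 : V)) = 0 := rfl
  simp only [e0, map_zero] at h3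
  rw [pair_eq, vert_smul, map_add, map_smul, smul_eq_mul]
  linarith

/-- The energy is constant in horizontal directions: `δ_w E = 0`. -/
theorem energy_horizontal (h : IsSpray D E G) {z : V × V} (hz : z ∈ D) (w : V) :
    fderiv ℝ E z (w, -fderiv ℝ G z (0, w)) = 0 := by
  have h1 := (hasFDerivAt_fderiv (h.smoothE z hz)).clm_apply
    ((hasFDerivAt_snd (𝕜 := ℝ) (p := z)).prodMk
      ((hasFDerivAt_of_smooth (h.smoothG z hz)).const_smul (-2 : ℝ)))
  have := hasFDerivAt_apply_eq h1 (hasFDerivAt_const (0 : ℝ) z)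
    ((h.eventually_mem hz).mono fun x hx => h.energy_spray hx) (0, w)
  have h2 := h.spray z hz w
  have hs := h.smoothE z hz
  simp only [add_apply, ContinuousLinearMap.comp_apply,
    ContinuousLinearMap.flip_apply, ContinuousLinearMap.prod_apply, ContinuousLinearMap.coe_snd',
    smul_apply, Pi.smul_apply, zero_apply] at this
  rw [pair_eq, vert_smul, pair_eq z.2, vert_smul] at this
  simp only [map_add, map_smul, smul_eq_mul] at this
  rw [d2_symm hs, d2_symm hs (0, w) (0, G z)] at this
  rw [pair_eq, vert_neg, map_add, map_neg]
  linarith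

/-- The horizontal Berwald derivative of the metric tensor is the Landsberg tensor; this is
`energy_horizontal` differentiated twice in vertical directions. -/
theorem metric_horizontal (h : IsSpray D E G) {z : V × V} (hz : z ∈ D) (a b w : V) :
    d3 E z (w, -fderiv ℝ G z (0, w)) (0, a) (0, b) =
      d2 E z (0, d2 G z (0, a) (0, w)) (0, b) + d2 E z (0, a) (0, d2 G z (0, b) (0, w))
        + landsberg E G z a b w := by
  have key : ∀ x ∈ D, d2 E x (0, b) (w, -fderiv ℝ G x (0, w))
      - fderiv ℝ E x (0, d2 G x (0, b) (0, w)) = 0 := fun x hx => by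
    have h1 := (hasFDerivAt_fderiv (h.smoothE x hx)).clm_apply
      ((hasFDerivAt_const w x).prodMk ((hasFDerivAt_fderiv (h.smoothG x hx)).clm_apply
        (hasFDerivAt_const ((0 : V), w) x)).neg)
    have := hasFDerivAt_apply_eq h1 (hasFDerivAt_const (0 : ℝ) x)
      ((h.eventually_mem hx).mono fun x hx => h.energy_horizontal hx w) (0, b)
    simp only [add_apply, ContinuousLinearMap.comp_apply,
      ContinuousLinearMap.flip_apply, ContinuousLinearMap.prod_apply,
      neg_apply, Pi.neg_apply, zero_apply, map_zero, zero_add, vert_neg,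
      map_neg] at this
    linarith
  have h0 := hasFDerivAt_fderiv (h.smoothE z hz)
  have h2 := hasFDerivAt_d2 (h.smoothE z hz)
  have g1 := hasFDerivAt_fderiv (h.smoothG z hz)
  have g2 := hasFDerivAt_d2 (h.smoothG z hz)
  have cb := hasFDerivAt_const (𝕜 := ℝ) ((0 : V), b) z
  have cw := hasFDerivAt_const (𝕜 := ℝ) ((0 : V), w) z
  have h3 := ((h2.clm_apply cb).clm_apply
      ((hasFDerivAt_const w z).prodMk (g1.clm_apply cw).neg)).sub
    (h0.clm_apply ((hasFDerivAt_const (0 : V) z).prodMk ((g2.clm_apply cb).clm_apply cw)))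
  have := hasFDerivAt_apply_eq h3 (hasFDerivAt_const (0 : ℝ) z)
    ((h.eventually_mem hz).mono key) (0, a)
  simp only [add_apply, sub_apply,
    ContinuousLinearMap.comp_apply, ContinuousLinearMap.flip_apply, ContinuousLinearMap.prod_apply,
    neg_apply, Pi.neg_apply, zero_apply, map_zero, zero_add, vert_neg,
    map_neg] at this
  have hs := h.smoothE z hz
  rw [d3_symm_right hs, d3_symm_left hs, d2_symm hs (0, b), d3_symm_right hs] at this
  rw [landsberg, d3_symm_right hs]
  linarith

theorem landsberg_swap (h : IsSpray D E G) {z : V × V} (hz : z ∈ D) (a b c : V) :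
    landsberg E G z a b c = landsberg E G z b a c := by
  rw [landsberg, d3_symm_left (h.smoothG z hz), landsberg]

theorem landsberg_swap_right (h : IsSpray D E G) {z : V × V} (hz : z ∈ D) (a b c : V) :
    landsberg E G z a b c = landsberg E G z a c b := by
  rw [landsberg, d3_symm_right (h.smoothG z hz), landsberg]

/-- Koszul's formula for the Cartan connection: it differs from the Berwald connection by the
Landsberg tensor. -/
theorem koszul (h : IsSpray D E G) {z : V × V} (hz : z ∈ D) (a b c : V) :
    d3 E z (a, -fderiv ℝ G z (0, a)) (0, c) (0, b) + d3 E z (b, -fderiv ℝ G z (0, b)) (0, a) (0, c)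
      - d3 E z (c, -fderiv ℝ G z (0, c)) (0, a) (0, b) =
      2 * d2 E z (0, c) (0, d2 G z (0, a) (0, b)) + landsberg E G z a b c := by
  rw [h.metric_horizontal hz, h.metric_horizontal hz, h.metric_horizontal hz]
  have hs := h.smoothE z hz
  have gs := h.smoothG z hz
  rw [h.landsberg_swap hz c b a, h.landsberg_swap_right hz b c a, h.landsberg_swap hz b a c,
    h.landsberg_swap_right hz a c b, d2_symm gs (0, c) (0, a), d2_symm gs (0, c) (0, b),
    d2_symm gs (0, b) (0, a), d2_symm hs (0, d2 G z (0, a) (0, b)) (0, c),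
    d2_symm hs (0, d2 G z (0, a) (0, c)) (0, b)]
  ring

end IsSpray

end Spray

/-! ### Totally geodesic hypersurfaces -/

section Hypersurface

variable {K V : Type*} [NormedAddCommGroup K] [NormedSpace ℝ K]
  [NormedAddCommGroup V] [NormedSpace ℝ V]

/-- The supporting element `(x(u), B v)` of a parametrized submanifold, as a function of
`q = (u, v)`. -/
noncomputable def tangentLift (p : K → V) (q : K × K) : V × V := (p q.1, fderiv ℝ p q.1 q.2)

theorem hasFDerivAt_tangentLift {p : K → V} {q : K × K} (hp : ContDiffAt ℝ ∞ p q.1) :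
    ∃ T : K × K →L[ℝ] V × V, HasFDerivAt (tangentLift p) T q ∧
      ∀ s w, T (s, w) = (fderiv ℝ p q.1 s, d2 p q.1 s q.2 + fderiv ℝ p q.1 w) := by
  have h1 := (hasFDerivAt_of_smooth hp).comp q (hasFDerivAt_fst (𝕜 := ℝ) (p := q))
  have h2 := ((hasFDerivAt_fderiv hp).comp q (hasFDerivAt_fst (𝕜 := ℝ) (p := q))).clm_apply
    (hasFDerivAt_snd (𝕜 := ℝ) (p := q))
  exact ⟨_, h1.prodMk h2, fun s w => by simp [add_comm]⟩

/-- `N` is a nowhere zero normal field, with respect to the metric with energy `E`, along the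
parametrized hypersurface `p`; `T` is the set of its admissible supporting elements `(u, v)`. The
field need not have unit length. -/
structure IsNormalField (D : Set (V × V)) (E : V × V → ℝ) (T : Set (K × K)) (p : K → V)
    (N : K × K → V) : Prop where
  isOpen : IsOpen T
  smooth_param : ∀ q ∈ T, ContDiffAt ℝ ∞ p q.1
  mem : ∀ q ∈ T, tangentLift p q ∈ D
  smooth_normal : ∀ q ∈ T, ContDiffAt ℝ ∞ N q
  orthogonal : ∀ q ∈ T, ∀ a, d2 E (tangentLift p q) (0, N q) (0, fderiv ℝ p q.1 a) = 0
  ne_zero : ∀ q ∈ T, N q ≠ 0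
  decompose : ∀ q ∈ T, ∀ w, ∃ (c : ℝ) (s : K), w = c • N q + fderiv ℝ p q.1 s

/-- `δ_a`, the horizontal lift of the tangent vector `B a`, is tangent to the set of supporting
elements `(x(u), B v)`, for all `a`. Equivalently the normal curvature vector vanishes: every
geodesic of the hypersurface is a geodesic of the surrounding space. -/
def IsHorizontallyTangent (G : V × V → V) (T : Set (K × K)) (p : K → V) : Prop :=
  ∀ q ∈ T, ∀ a, ∃ w,
    d2 p q.1 a q.2 + fderiv ℝ p q.1 w = -fderiv ℝ G (tangentLift p q) (0, fderiv ℝ p q.1 a)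

/-- `M_αβ = 0`, for the normal field `N`. -/
def HasZeroCartan (E : V × V → ℝ) (T : Set (K × K)) (p : K → V) (N : K × K → V) : Prop :=
  ∀ q ∈ T, ∀ a b, d3 E (tangentLift p q) (0, fderiv ℝ p q.1 a) (0, fderiv ℝ p q.1 b) (0, N q) = 0

/-- The Landsberg tensor vanishes on two tangent vectors and the normal. -/
def HasZeroLandsberg (E : V × V → ℝ) (G : V × V → V) (T : Set (K × K)) (p : K → V)
    (N : K × K → V) : Prop :=
  ∀ q ∈ T, ∀ a b,
    landsberg E G (tangentLift p q) (fderiv ℝ p q.1 a) (fderiv ℝ p q.1 b) (N q) = 0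

namespace IsNormalField

variable {D : Set (V × V)} {E : V × V → ℝ} {G : V × V → V} {T : Set (K × K)} {p : K → V}
  {N : K × K → V}

theorem eventually_mem (hN : IsNormalField D E T p N) {q : K × K} (hq : q ∈ T) :
    ∀ᶠ x in nhds q, x ∈ T :=
  hN.isOpen.mem_nhds hq

theorem metric_normal_ne_zero (hN : IsNormalField D E T p N) (h : IsSpray D E G) {q : K × K}
    (hq : q ∈ T) : d2 E (tangentLift p q) (0, N q) (0, N q) ≠ 0 := fun h0 => by
  refine hN.ne_zero q hq (h.nondegenerate _ (hN.mem q hq) _ fun w => ?_)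
  obtain ⟨c, s, rfl⟩ := hN.decompose q hq w
  rw [vert_add, vert_smul, map_add, map_smul, h0, hN.orthogonal q hq, smul_zero, add_zero]

theorem tangent_of_metric (hN : IsNormalField D E T p N) (h : IsSpray D E G) {q : K × K}
    (hq : q ∈ T) {w : V} (hw : d2 E (tangentLift p q) (0, N q) (0, w) = 0) :
    ∃ s, w = fderiv ℝ p q.1 s := by
  obtain ⟨c, s, rfl⟩ := hN.decompose q hq w
  rw [vert_add, vert_smul, map_add, map_smul, hN.orthogonal q hq, add_zero, smul_eq_mul] at hw
  have hc := (mul_eq_zero.1 hw).resolve_right (hN.metric_normal_ne_zero h hq)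
  exact ⟨s, by simp [hc]⟩

theorem normal_of_metric (hN : IsNormalField D E T p N) (h : IsSpray D E G) {q : K × K}
    (hq : q ∈ T) {w : V}
    (hw : ∀ a, d2 E (tangentLift p q) (0, w) (0, fderiv ℝ p q.1 a) = 0) :
    ∃ c : ℝ, w = c • N q := by
  obtain ⟨c, s, hs⟩ := hN.decompose q hq w
  have hE := h.smoothE _ (hN.mem q hq)
  refine ⟨c, ?_⟩
  have h1 : fderiv ℝ p q.1 s = 0 := by
    refine h.nondegenerate _ (hN.mem q hq) _ fun x => ?_
    obtain ⟨c', s', rfl⟩ := hN.decompose q hq x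
    have h2 := hw s'
    rw [hs, vert_add, vert_smul, map_add, map_smul, add_apply,
      smul_apply, hN.orthogonal q hq, smul_zero, zero_add] at h2
    rw [vert_add, vert_smul, map_add, map_smul, h2, d2_symm hE, hN.orthogonal q hq]
    simp
  rw [hs, h1, add_zero]

theorem orthogonal_smul (hN : IsNormalField D E T p N) {q : K × K} (hq : q ∈ T) (c : ℝ) (a : K) :
    d2 E (tangentLift p q) (0, c • N q) (0, fderiv ℝ p q.1 a) = 0 := by
  rw [vert_smul, map_smul, smul_apply, hN.orthogonal q hq, smul_zero]

/-- The Liouville vector is tangent, so `E'(0, N) = g(y, N) = 0`. -/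
theorem energy_normal (hN : IsNormalField D E T p N) (h : IsSpray D E G) {q : K × K}
    (hq : q ∈ T) : fderiv ℝ E (tangentLift p q) (0, N q) = 0 := by
  rw [← h.metric_self (hN.mem q hq)]
  exact hN.orthogonal q hq q.2

/-- The equation `g(N, B b) = 0`, differentiated along the hypersurface. -/
theorem orthogonal_deriv (hN : IsNormalField D E T p N) (h : IsSpray D E G) {q : K × K}
    (hq : q ∈ T) (s w b : K) :
    d3 E (tangentLift p q) (fderiv ℝ p q.1 s, d2 p q.1 s q.2 + fderiv ℝ p q.1 w)
        (0, N q) (0, fderiv ℝ p q.1 b)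
      + d2 E (tangentLift p q) (0, fderiv ℝ N q (s, w)) (0, fderiv ℝ p q.1 b)
      + d2 E (tangentLift p q) (0, N q) (0, d2 p q.1 s b) = 0 := by
  obtain ⟨T', hT, hT'⟩ := hasFDerivAt_tangentLift (hN.smooth_param q hq)
  have hE := h.smoothE _ (hN.mem q hq)
  have hg : HasFDerivAt (fun x => d2 E (tangentLift p x)) ((d3 E (tangentLift p q)).comp T') q :=
    HasFDerivAt.comp (g := d2 E) q (hasFDerivAt_d2 hE) hT
  have hB : HasFDerivAt (fun x : K × K => fderiv ℝ p x.1) _ q :=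
    (hasFDerivAt_fderiv (hN.smooth_param q hq)).comp q (hasFDerivAt_fst (𝕜 := ℝ) (p := q))
  have h1 := (hg.clm_apply ((hasFDerivAt_const (0 : V) q).prodMk
    (hasFDerivAt_of_smooth (hN.smooth_normal q hq)))).clm_apply
    ((hasFDerivAt_const (0 : V) q).prodMk (hB.clm_apply (hasFDerivAt_const b q)))
  have := hasFDerivAt_apply_eq h1 (hasFDerivAt_const (0 : ℝ) q)
    ((hN.eventually_mem hq).mono fun x hx => hN.orthogonal x hx b) (s, w)
  simp [hT'] at this
  linarith

/-- The vertical derivative of a tangent field, at a fixed point of the hypersurface, is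
tangent. -/
theorem tangent_vertical_deriv (hN : IsNormalField D E T p N) {q : K × K} (hq : q ∈ T)
    {W : K → V} {W' : K →L[ℝ] V} (hW : HasFDerivAt W W' q.2)
    (ht : ∀ r, (q.1, r) ∈ T → ∃ s, W r = fderiv ℝ p q.1 s) (k : K) :
    d2 E (tangentLift p q) (0, N q) (0, W' k) = 0 := by
  have h1 := (hasFDerivAt_const (d2 E (tangentLift p q) (0, N q)) q.2).clm_apply
    ((hasFDerivAt_const (0 : V) q.2).prodMk hW)
  have hev : ∀ᶠ r in nhds q.2, (q.1, r) ∈ T :=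
    (Continuous.prodMk_right q.1).continuousAt.eventually (hN.eventually_mem hq)
  have := hasFDerivAt_apply_eq h1 (hasFDerivAt_const (0 : ℝ) q.2) (hev.mono fun r hr => by
    obtain ⟨s, hs⟩ := ht r hr
    rw [hs]
    exact hN.orthogonal q hq s) k
  simpa using this

theorem hasFDerivAt_tangentLift_vertical (p : K → V) (q : K × K) :
    HasFDerivAt (fun r => tangentLift p (q.1, r))
      ((0 : K →L[ℝ] V).prod (fderiv ℝ p q.1)) q.2 :=
  (hasFDerivAt_const (p q.1) q.2).prodMk (fderiv ℝ p q.1).hasFDerivAt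

/-- The spray being tangent to the hypersurface is enough for `IsHorizontallyTangent`: take a
vertical derivative. -/
theorem isHorizontallyTangent_of_spray (hN : IsNormalField D E T p N) (h : IsSpray D E G)
    (ht : ∀ q ∈ T, ∃ s, d2 p q.1 q.2 q.2 + (2 : ℝ) • G (tangentLift p q) = fderiv ℝ p q.1 s) :
    IsHorizontallyTangent G T p := fun q hq a => by
  have hG : HasFDerivAt (fun r => G (tangentLift p (q.1, r))) _ q.2 :=
    HasFDerivAt.comp q.2 (hasFDerivAt_of_smooth (h.smoothG _ (hN.mem q hq)))
      (hasFDerivAt_tangentLift_vertical p q)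
  have h1 := ((d2 p q.1).hasFDerivAt (x := q.2)).clm_apply (hasFDerivAt_id q.2)
  have := hN.tangent_vertical_deriv hq (h1.add (hG.const_smul (2 : ℝ)))
    (fun r hr => ht (q.1, r) hr) a
  simp at this
  rw [d2_symm (hN.smooth_param q hq) q.2 a, ← two_smul ℝ, ← smul_add, vert_smul, map_smul,
    smul_eq_mul] at this
  obtain ⟨s, hs⟩ := hN.tangent_of_metric h hq ((mul_eq_zero.1 this).resolve_left two_ne_zero)
  refine ⟨-s, ?_⟩
  rw [map_neg, ← hs]
  simp

/-- The vertical derivative of the normal curvature vector: the second fundamental form taken with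
the Berwald connection vanishes as well. -/
theorem metric_second_fundamental (hN : IsNormalField D E T p N) (h : IsSpray D E G)
    (ht : IsHorizontallyTangent G T p) {q : K × K} (hq : q ∈ T) (a b : K) :
    d2 E (tangentLift p q) (0, N q) (0, d2 p q.1 a b
      + d2 G (tangentLift p q) (0, fderiv ℝ p q.1 a) (0, fderiv ℝ p q.1 b)) = 0 := by
  have hG : HasFDerivAt (fun r => fderiv ℝ G (tangentLift p (q.1, r))) _ q.2 :=
    HasFDerivAt.comp q.2 (hasFDerivAt_fderiv (h.smoothG _ (hN.mem q hq)))
      (hasFDerivAt_tangentLift_vertical p q)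
  have h1 := (d2 p q.1 b).hasFDerivAt (x := q.2)
  have := hN.tangent_vertical_deriv hq
    (h1.add (hG.clm_apply (hasFDerivAt_const ((0 : V), fderiv ℝ p q.1 b) q.2)))
    (fun r hr => by
      obtain ⟨w, hw⟩ := ht (q.1, r) hr b
      refine ⟨-w, ?_⟩
      simp only at hw
      rw [map_neg, eq_neg_iff_add_eq_zero, Pi.add_apply, add_right_comm, hw]
      simp) a
  simp at this
  rwa [d2_symm (hN.smooth_param q hq) a b]

/-- Since `g(N, B b) = 0`, the tensor `M_αβ` is minus the tangential part of the vertical derivative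
of the normal field. -/
theorem cartan_eq (hN : IsNormalField D E T p N) (h : IsSpray D E G) {q : K × K}
    (hq : q ∈ T) (a b : K) :
    d3 E (tangentLift p q) (0, fderiv ℝ p q.1 a) (0, fderiv ℝ p q.1 b) (0, N q)
      = -d2 E (tangentLift p q) (0, fderiv ℝ N q (0, a)) (0, fderiv ℝ p q.1 b) := by
  have := hN.orthogonal_deriv h hq 0 a b
  have e0 : ((0 : V), (0 : V)) = 0 := rfl
  simp only [map_zero, zero_apply, zero_add, e0, add_zero] at this
  rw [d3_symm_right (h.smoothE _ (hN.mem q hq))]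
  linarith

/-- The Landsberg tensor on the hypersurface is minus the tangential part of the horizontal Berwald
derivative of the normal field: only the direction `N` of the normal and the spray enter. -/
theorem landsberg_eq (hN : IsNormalField D E T p N) (h : IsSpray D E G)
    (ht : IsHorizontallyTangent G T p) {q : K × K} (hq : q ∈ T) {a w : K}
    (hw : d2 p q.1 a q.2 + fderiv ℝ p q.1 w
      = -fderiv ℝ G (tangentLift p q) (0, fderiv ℝ p q.1 a)) (b : K) :
    landsberg E G (tangentLift p q) (fderiv ℝ p q.1 a) (fderiv ℝ p q.1 b) (N q)
      = -d2 E (tangentLift p q) (0, fderiv ℝ N q (a, w)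
        + d2 G (tangentLift p q) (0, N q) (0, fderiv ℝ p q.1 a)) (0, fderiv ℝ p q.1 b) := by
  have h1 := hN.orthogonal_deriv h hq a w b
  have hz := hN.mem q hq
  rw [hw, h.metric_horizontal hz] at h1
  have h2 := hN.metric_second_fundamental h ht hq a b
  rw [vert_add, map_add, d2_symm (h.smoothG _ hz)] at h2
  rw [h.landsberg_swap hz, h.landsberg_swap_right hz, h.landsberg_swap hz,
    h.landsberg_swap_right hz, h.landsberg_swap hz, h.landsberg_swap_right hz, vert_add, map_add,
    add_apply]
  have h3 : landsberg E G (tangentLift p q) (N q) (fderiv ℝ p q.1 b) (fderiv ℝ p q.1 a)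
     = landsberg E G (tangentLift p q) (fderiv ℝ p q.1 a) (fderiv ℝ p q.1 b) (N q) := by
    rw [h.landsberg_swap hz, h.landsberg_swap_right hz, h.landsberg_swap hz]
  linarith

/-- `M_αβ = 0` says that the direction of the normal has zero derivative in the supporting element
`v`. -/
theorem hasZeroCartan_iff (hN : IsNormalField D E T p N) (h : IsSpray D E G) :
    HasZeroCartan E T p N ↔ ∀ q ∈ T, ∀ a, ∃ c : ℝ, fderiv ℝ N q (0, a) = c • N q := by
  refine ⟨fun hM q hq a => hN.normal_of_metric h hq fun b => ?_, fun hM q hq a b => ?_⟩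
  · rw [← neg_eq_zero, ← hN.cartan_eq h hq, hM q hq]
  · obtain ⟨c, hc⟩ := hM q hq a
    rw [hN.cartan_eq h hq, hc, hN.orthogonal_smul hq, neg_zero]

/-- On a totally geodesic hypersurface with vanishing Landsberg tensor, the direction of the normal
is parallel for the Berwald connection. -/
theorem normal_of_hasZeroLandsberg (hN : IsNormalField D E T p N) (h : IsSpray D E G)
    (ht : IsHorizontallyTangent G T p) (hl : HasZeroLandsberg E G T p N) {q : K × K} (hq : q ∈ T)
    {a w : K} (hw : d2 p q.1 a q.2 + fderiv ℝ p q.1 w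
      = -fderiv ℝ G (tangentLift p q) (0, fderiv ℝ p q.1 a)) :
    ∃ c : ℝ, fderiv ℝ N q (a, w)
      + d2 G (tangentLift p q) (0, N q) (0, fderiv ℝ p q.1 a) = c • N q :=
  hN.normal_of_metric h hq fun b => by
    rw [← neg_eq_zero, ← hN.landsberg_eq h ht hq hw, hl q hq]

/-- The normal curvature vector `H_α = N_i (B^i_0α + N^i_j B^j_α)`, for a normal field of any
length. -/
noncomputable def curvatureVec (E : V × V → ℝ) (G : V × V → V) (p : K → V) (N : K × K → V)
    (q : K × K) (a : K) : ℝ :=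
  d2 E (tangentLift p q) (0, N q)
    (0, d2 p q.1 a q.2 + fderiv ℝ G (tangentLift p q) (0, fderiv ℝ p q.1 a))

/-- The part `N_i (B^i_αβ + F^i_jk B^j_α B^k_β)` of the second fundamental `h`-tensor, with the
Cartan connection written out by Koszul's formula, for a normal field of any length. -/
noncomputable def curvatureTensor (E : V × V → ℝ) (G : V × V → V) (p : K → V) (N : K × K → V)
    (q : K × K) (a b : K) : ℝ :=
  d2 E (tangentLift p q) (0, N q) (0, d2 p q.1 a b) + 1 / 2 *
    (d3 E (tangentLift p q) (fderiv ℝ p q.1 a, -fderiv ℝ G (tangentLift p q) (0, fderiv ℝ p q.1 a))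
        (0, N q) (0, fderiv ℝ p q.1 b)
      + d3 E (tangentLift p q)
        (fderiv ℝ p q.1 b, -fderiv ℝ G (tangentLift p q) (0, fderiv ℝ p q.1 b))
        (0, fderiv ℝ p q.1 a) (0, N q)
      - d3 E (tangentLift p q) (N q, -fderiv ℝ G (tangentLift p q) (0, N q))
        (0, fderiv ℝ p q.1 a) (0, fderiv ℝ p q.1 b))

theorem curvatureTensor_eq (hN : IsNormalField D E T p N) (h : IsSpray D E G) {q : K × K}
    (hq : q ∈ T) (a b : K) :
    curvatureTensor E G p N q a b = d2 E (tangentLift p q) (0, N q) (0, d2 p q.1 a b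
      + d2 G (tangentLift p q) (0, fderiv ℝ p q.1 a) (0, fderiv ℝ p q.1 b)) + 1 / 2 *
      landsberg E G (tangentLift p q) (fderiv ℝ p q.1 a) (fderiv ℝ p q.1 b) (N q) := by
  rw [curvatureTensor, h.koszul (hN.mem q hq), vert_add, map_add]
  ring

/-- A vanishing second fundamental `h`-tensor `H_αβ` (the coefficient `c` stands for the length of
the normal) means that the hypersurface is totally geodesic and that the Landsberg tensor vanishes
along it. Contraction with `v^α` gives the first part. -/
theorem of_curvature_eq_zero (hN : IsNormalField D E T p N) (h : IsSpray D E G)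
    (hH : ∀ q ∈ T, ∃ c : ℝ, ∀ a b, curvatureTensor E G p N q a b
      + c * d3 E (tangentLift p q) (0, fderiv ℝ p q.1 a) (0, N q) (0, N q)
        * curvatureVec E G p N q b = 0) :
    IsHorizontallyTangent G T p ∧ HasZeroLandsberg E G T p N := by
  have hvec : ∀ q ∈ T, ∀ b, curvatureVec E G p N q b = 0 := fun q hq b => by
    obtain ⟨c, hc⟩ := hH q hq
    have h1 := hc q.2 b
    have hz := hN.mem q hq
    have hE := h.smoothE _ hz
    have hG := h.smoothG _ hz
    have e : fderiv ℝ p q.1 q.2 = (tangentLift p q).2 := rfl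
    rw [hN.curvatureTensor_eq h hq, e, d3_symm_left hE, d3_symm_right hE, h.cartan_self hz,
      d2_symm hG, h.d2_spray_vert_self hz, landsberg, d3_symm_left hG, d3_symm_right hG,
      h.d3_spray_self hz, d2_symm (hN.smooth_param q hq)] at h1
    have e0 : ((0 : V), (0 : V)) = 0 := rfl
    simpa [e0, curvatureVec] using h1
  have ht : IsHorizontallyTangent G T p := fun q hq a => by
    obtain ⟨s, hs⟩ := hN.tangent_of_metric h hq (hvec q hq a)
    exact ⟨-s, by rw [map_neg, ← hs]; simp⟩
  refine ⟨ht, fun q hq a b => ?_⟩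
  obtain ⟨c, hc⟩ := hH q hq
  have h1 := hc a b
  rw [hvec q hq b, hN.curvatureTensor_eq h hq, hN.metric_second_fundamental h ht hq] at h1
  linarith

theorem curvatureTensor_eq_zero (hN : IsNormalField D E T p N) (h : IsSpray D E G)
    (ht : IsHorizontallyTangent G T p) (hl : HasZeroLandsberg E G T p N) {q : K × K} (hq : q ∈ T)
    (a b : K) : curvatureTensor E G p N q a b = 0 := by
  rw [hN.curvatureTensor_eq h hq, hN.metric_second_fundamental h ht hq, hl q hq]
  simp

theorem curvatureVec_eq_zero (hN : IsNormalField D E T p N)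
    (ht : IsHorizontallyTangent G T p) {q : K × K} (hq : q ∈ T) (a : K) :
    curvatureVec E G p N q a = 0 := by
  obtain ⟨w, hw⟩ := ht q hq a
  have : d2 p q.1 a q.2 + fderiv ℝ G (tangentLift p q) (0, fderiv ℝ p q.1 a)
      = fderiv ℝ p q.1 (-w) := by
    rw [map_neg, eq_neg_iff_add_eq_zero, add_right_comm, hw]
    simp
  rw [curvatureVec, this, hN.orthogonal q hq]

end IsNormalField

end Hypersurface

/-! ### The change of metric -/

section Change

variable {K V : Type*} [NormedAddCommGroup K] [NormedSpace ℝ K]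
  [NormedAddCommGroup V] [NormedSpace ℝ V]
  {D : Set (V × V)} {E E' : V × V → ℝ} {G G' : V × V → V} {T : Set (K × K)} {p : K → V}
  {N : K × K → V}

theorem IsSpray.fderiv_sub (h : IsSpray D E G) (h' : IsSpray D E' G') {z : V × V} (hz : z ∈ D) :
    fderiv ℝ (fun x => G' x - G x) z = fderiv ℝ G' z - fderiv ℝ G z :=
  ((hasFDerivAt_of_smooth (h'.smoothG z hz)).sub (hasFDerivAt_of_smooth (h.smoothG z hz))).fderiv

theorem IsSpray.d2_sub (h : IsSpray D E G) (h' : IsSpray D E' G') {z : V × V} (hz : z ∈ D) :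
    d2 (fun x => G' x - G x) z = d2 G' z - d2 G z :=
  (((hasFDerivAt_fderiv (h'.smoothG z hz)).sub
    (hasFDerivAt_fderiv (h.smoothG z hz))).congr_of_eventuallyEq
      ((h.eventually_mem hz).mono fun _ hx => h.fderiv_sub h' hx)).fderiv

theorem hasZeroCartan_perm (h : IsSpray D E G) (hN : IsNormalField D E T p N)
    (hM : HasZeroCartan E T p N) {q : K × K} (hq : q ∈ T) (a b : K) (c : ℝ) :
    d3 E (tangentLift p q) (0, fderiv ℝ p q.1 a) (0, c • N q) (0, fderiv ℝ p q.1 b) = 0 := by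
  have hE := h.smoothE _ (hN.mem q hq)
  rw [d3_symm_right hE, vert_smul, map_smul, hM q hq, smul_zero]

/-- Two metrics with the same normal directions along a hypersurface, whose sprays differ by a
vector field `Δ` of the form given by `hR`. If `σ` and `μ` have no normal derivative, then `Δ` is
tangent and its normal derivative is normal, so that the difference of the Berwald connections
preserves the direction of the normal. -/
theorem hyperplane_transfer (h : IsSpray D E G) (h' : IsSpray D E' G')
    (hN : IsNormalField D E T p N) (hN' : IsNormalField D E' T p N) {σ μ : V × V → ℝ}
    (hσ : ∀ z ∈ D, ContDiffAt ℝ ∞ σ z) (hμ : ∀ z ∈ D, ContDiffAt ℝ ∞ μ z)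
    (hR : ∀ z ∈ D, ∀ w, 2 * d2 E' z (0, G' z - G z) (0, w)
      = σ z * (2 * fderiv ℝ E' z (0, w) - μ z * fderiv ℝ E z (0, w)))
    (hσN : ∀ q ∈ T, fderiv ℝ σ (tangentLift p q) (0, N q) = 0)
    (hμN : ∀ q ∈ T, fderiv ℝ μ (tangentLift p q) (0, N q) = 0)
    (ht : IsHorizontallyTangent G T p) (hl : HasZeroLandsberg E G T p N)
    (hM : HasZeroCartan E T p N) :
    IsHorizontallyTangent G' T p ∧ HasZeroLandsberg E' G' T p N ∧ HasZeroCartan E' T p N := by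
  have hM' : HasZeroCartan E' T p N :=
    (hN'.hasZeroCartan_iff h').2 ((hN.hasZeroCartan_iff h).1 hM)
  set Δ : V × V → V := fun x => G' x - G x with hΔ
  have hΔs : ∀ z ∈ D, ContDiffAt ℝ ∞ Δ z := fun z hz => (h'.smoothG z hz).sub (h.smoothG z hz)
  have htan : ∀ q ∈ T, ∃ s, Δ (tangentLift p q) = fderiv ℝ p q.1 s := fun q hq => by
    have hz := hN.mem q hq
    refine hN'.tangent_of_metric h' hq ?_
    have := hR _ hz (N q)
    rw [hN.energy_normal h hq, hN'.energy_normal h' hq, d2_symm (h'.smoothE _ hz)] at this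
    rw [hΔ]
    linarith
  have ht' : IsHorizontallyTangent G' T p := by
    refine hN'.isHorizontallyTangent_of_spray h' fun q hq => ?_
    obtain ⟨s, hs⟩ := htan q hq
    obtain ⟨w, hw⟩ := ht q hq q.2
    have e : fderiv ℝ p q.1 q.2 = (tangentLift p q).2 := rfl
    rw [e, h.fderiv_spray_self (hN.mem q hq), eq_comm, neg_eq_iff_eq_neg] at hw
    refine ⟨(2 : ℝ) • s - w, ?_⟩
    have : G' (tangentLift p q) = G (tangentLift p q) + Δ (tangentLift p q) := by simp [hΔ]
    rw [this, smul_add, hw, hs, map_sub, map_smul]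
    abel
  -- `Δ'(0, N)` is orthogonal to the hypersurface: differentiate `hR` in the direction `N`.
  have hnorm : ∀ q ∈ T, ∃ c : ℝ, fderiv ℝ Δ (tangentLift p q) (0, N q) = c • N q := by
    intro q hq
    have hz := hN.mem q hq
    refine hN'.normal_of_metric h' hq fun a => ?_
    set z := tangentLift p q with hzq
    have c0 := hasFDerivAt_const (𝕜 := ℝ) ((0 : V), fderiv ℝ p q.1 a) z
    have h1 := (((hasFDerivAt_d2 (h'.smoothE z hz)).clm_apply ((hasFDerivAt_const (0 : V) z).prodMk
      (hasFDerivAt_of_smooth (hΔs z hz)))).clm_apply c0).const_mul 2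
    have h2 := (hasFDerivAt_of_smooth (hσ z hz)).mul
      ((((hasFDerivAt_fderiv (h'.smoothE z hz)).clm_apply c0).const_mul 2).sub
        ((hasFDerivAt_of_smooth (hμ z hz)).mul
          ((hasFDerivAt_fderiv (h.smoothE z hz)).clm_apply c0)))
    have := hasFDerivAt_apply_eq h1 h2
      ((h.eventually_mem hz).mono fun x hx => hR x hx (fderiv ℝ p q.1 a)) (0, N q)
    have e1 := hN.orthogonal q hq a
    have e2 := hN'.orthogonal q hq a
    have e3 := hσN q hq
    have e4 := hμN q hq
    obtain ⟨s, hs⟩ := htan q hq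
    have e5 := hM' q hq s a
    rw [d3_symm_right (h'.smoothE z hz), d3_symm_left (h'.smoothE z hz)] at e5
    rw [← hzq] at e1 e2 e3 e4 hs
    simpa [e1, e2, e3, e4, e5, hs] using this
  -- The same for `Δ''(0, N)(0, B a)`: differentiate once more, along the hypersurface.
  have hnorm2 : ∀ q ∈ T, ∀ a, ∃ c : ℝ,
      d2 Δ (tangentLift p q) (0, N q) (0, fderiv ℝ p q.1 a) = c • N q := by
    intro q hq a
    have hz := hN.mem q hq
    refine hN'.normal_of_metric h' hq fun b => ?_
    obtain ⟨T', hT, hT'⟩ := hasFDerivAt_tangentLift (hN.smooth_param q hq)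
    have hg : HasFDerivAt (fun x => d2 E' (tangentLift p x))
        ((d3 E' (tangentLift p q)).comp T') q :=
      HasFDerivAt.comp (g := d2 E') q (hasFDerivAt_d2 (h'.smoothE _ hz)) hT
    have hd : HasFDerivAt (fun x => fderiv ℝ Δ (tangentLift p x))
        ((d2 Δ (tangentLift p q)).comp T') q :=
      HasFDerivAt.comp (g := fderiv ℝ Δ) q (hasFDerivAt_fderiv (hΔs _ hz)) hT
    have hB : HasFDerivAt (fun x : K × K => fderiv ℝ p x.1) _ q :=
      (hasFDerivAt_fderiv (hN.smooth_param q hq)).comp q (hasFDerivAt_fst (𝕜 := ℝ) (p := q))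
    have h1 := (hg.clm_apply ((hasFDerivAt_const (0 : V) q).prodMk
      (hd.clm_apply ((hasFDerivAt_const (0 : V) q).prodMk
        (hasFDerivAt_of_smooth (hN.smooth_normal q hq)))))).clm_apply
      ((hasFDerivAt_const (0 : V) q).prodMk (hB.clm_apply (hasFDerivAt_const b q)))
    have := hasFDerivAt_apply_eq h1 (hasFDerivAt_const (0 : ℝ) q)
      ((hN.eventually_mem hq).mono fun x hx => by
        obtain ⟨c, hc⟩ := hnorm x hx
        rw [hc, hN'.orthogonal_smul hx]) (0, a)
    obtain ⟨c, hc⟩ := hnorm q hq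
    obtain ⟨c', hc'⟩ := (hN.hasZeroCartan_iff h).1 hM q hq a
    have e1 := hN'.orthogonal_smul hq (c' * c) b
    have e2 := hasZeroCartan_perm h' hN' hM' hq a b c
    have e0 : ((0 : V), (0 : V)) = 0 := rfl
    simp only [add_apply, ContinuousLinearMap.comp_apply, ContinuousLinearMap.flip_apply,
      ContinuousLinearMap.prod_apply, hT', hc', vert_smul c', map_smul, hc, smul_smul, map_zero,
      zero_apply, zero_add, e2, ContinuousLinearMap.coe_fst', e0, add_zero] at this
    rw [vert_add, map_add, add_apply, e1, zero_add, d2_symm (hΔs _ hz)] at this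
    exact this
  refine ⟨ht', fun q hq a b => ?_, hM'⟩
  have hz := hN.mem q hq
  obtain ⟨w, hw⟩ := ht q hq a
  obtain ⟨w', hw'⟩ := ht' q hq a
  obtain ⟨c₁, h₁⟩ := hN.normal_of_hasZeroLandsberg h ht hl hq hw
  obtain ⟨c₂, h₂⟩ := (hN.hasZeroCartan_iff h).1 hM q hq (w' - w)
  obtain ⟨c₃, h₃⟩ := hnorm2 q hq a
  have e : fderiv ℝ N q (a, w') + d2 G' (tangentLift p q) (0, N q) (0, fderiv ℝ p q.1 a)
      = (c₁ + c₂ + c₃) • N q := by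
    have e1 : (a, w') = (a, w) + (0, w' - w) := by simp
    rw [hΔ, h.d2_sub h' hz, sub_apply, sub_apply, sub_eq_iff_eq_add] at h₃
    rw [e1, map_add, h₂, h₃, add_smul, add_smul, ← h₁]
    abel
  rw [hN'.landsberg_eq h' ht' hq hw', e, hN'.orthogonal_smul hq, neg_zero]

theorem fderiv_mul_apply {f g : V → ℝ} {z : V} (hf : ContDiffAt ℝ ∞ f z)
    (hg : ContDiffAt ℝ ∞ g z) (k : V) :
    fderiv ℝ (fun x => f x * g x) z k = f z * fderiv ℝ g z k + g z * fderiv ℝ f z k := by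
  have := ((hasFDerivAt_of_smooth hf).mul (hasFDerivAt_of_smooth hg)).fderiv
  rw [show (fun x => f x * g x) = f * g from rfl, this]
  simp

theorem d2_mul_apply {f g : V → ℝ} {s : Set V} (hs : IsOpen s)
    (hf : ∀ z ∈ s, ContDiffAt ℝ ∞ f z) (hg : ∀ z ∈ s, ContDiffAt ℝ ∞ g z) {z : V} (hz : z ∈ s)
    (k l : V) :
    d2 (fun x => f x * g x) z k l = f z * d2 g z k l + fderiv ℝ f z k * fderiv ℝ g z l
      + g z * d2 f z k l + fderiv ℝ g z k * fderiv ℝ f z l := by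
  have hm := (hf z hz).mul (hg z hz)
  have cl := hasFDerivAt_const (𝕜 := ℝ) l z
  have h1 := (hasFDerivAt_fderiv hm).clm_apply cl
  have h2 := ((hasFDerivAt_of_smooth (hf z hz)).mul
    ((hasFDerivAt_fderiv (hg z hz)).clm_apply cl)).add
    ((hasFDerivAt_of_smooth (hg z hz)).mul ((hasFDerivAt_fderiv (hf z hz)).clm_apply cl))
  have := hasFDerivAt_apply_eq h1 h2 (Filter.mem_of_superset (hs.mem_nhds hz) fun x hx =>
    fderiv_mul_apply (hf x hx) (hg x hx) l) k
  simp at this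
  rw [this]
  ring

theorem fderiv_exp_apply {f : V → ℝ} {z : V} (hf : ContDiffAt ℝ ∞ f z) (k : V) :
    fderiv ℝ (fun x => Real.exp (2 * f x)) z k = Real.exp (2 * f z) * (2 * fderiv ℝ f z k) := by
  rw [(((hasFDerivAt_of_smooth hf).const_mul 2).exp).fderiv]
  simp

theorem smooth_exp {f : V → ℝ} {z : V} (hf : ContDiffAt ℝ ∞ f z) :
    ContDiffAt ℝ ∞ (fun x => Real.exp (2 * f x)) z :=
  (contDiffAt_const.mul hf).exp

theorem d2_exp_apply {f : V → ℝ} {s : Set V} (hs : IsOpen s)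
    (hf : ∀ z ∈ s, ContDiffAt ℝ ∞ f z) {z : V} (hz : z ∈ s) (k l : V) :
    d2 (fun x => Real.exp (2 * f x)) z k l = Real.exp (2 * f z) *
      (4 * fderiv ℝ f z k * fderiv ℝ f z l + 2 * d2 f z k l) := by
  have cl := hasFDerivAt_const (𝕜 := ℝ) l z
  have h1 := (hasFDerivAt_fderiv (smooth_exp (hf z hz))).clm_apply cl
  have h2 := (hasFDerivAt_of_smooth (smooth_exp (hf z hz))).mul
    (((hasFDerivAt_fderiv (hf z hz)).clm_apply cl).const_mul 2)
  have := hasFDerivAt_apply_eq h1 h2 (Filter.mem_of_superset (hs.mem_nhds hz) fun x hx =>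
    fderiv_exp_apply (hf x hx) l) k
  simp [fderiv_exp_apply (hf z hz)] at this
  rw [this]
  ring

/-- A function `β` on `D` for which the metric with energy `½ L² e^{2β/L}` is compared with the one
of energy `½ L²`; `G` and `G'` are the two sprays. The field `gradient` is the Euler–Lagrange
equation `S (∂β/∂y^i) = ∂β/∂x^i`, with the spray vector field `S = (y, -2G)`. It is what remains of
the gradient condition for the `h`-vector `b_i = ∂β/∂y^i`. -/
structure IsGradientChange (D : Set (V × V)) (L β : V × V → ℝ) (G G' : V × V → V) : Prop where
  smoothL : ∀ z ∈ D, ContDiffAt ℝ ∞ L z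
  smooth : ∀ z ∈ D, ContDiffAt ℝ ∞ β z
  pos : ∀ z ∈ D, 0 < L z
  spray : IsSpray D (fun z => 1 / 2 * (L z * L z)) G
  spray' : IsSpray D (fun z => 1 / 2 * (L z * L z) * Real.exp (2 * (β z / L z))) G'
  gradient : ∀ z ∈ D, ∀ w, d2 β z (z.2, (-2 : ℝ) • G z) (0, w) = fderiv ℝ β z (w, 0)


namespace IsGradientChange

variable {L β : V × V → ℝ}

theorem smooth_ratio (h : IsGradientChange D L β G G') :
    ∀ z ∈ D, ContDiffAt ℝ ∞ (fun x => β x / L x) z :=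
  fun z hz => (h.smooth z hz).div (h.smoothL z hz) (h.pos z hz).ne'

theorem smooth_square (h : IsGradientChange D L β G G') :
    ∀ z ∈ D, ContDiffAt ℝ ∞ (fun x => L x * L x) z :=
  fun z hz => (h.smoothL z hz).mul (h.smoothL z hz)

theorem ratio_eventuallyEq (h : IsGradientChange D L β G G') {z : V × V} (hz : z ∈ D) :
    β =ᶠ[nhds z] fun x => β x / L x * L x :=
  (h.spray.eventually_mem hz).mono fun x hx => (div_mul_cancel₀ _ (h.pos x hx).ne').symm

theorem fderiv_beta (h : IsGradientChange D L β G G') {z : V × V} (hz : z ∈ D) (k : V × V) :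
    fderiv ℝ β z k = β z / L z * fderiv ℝ L z k
      + L z * fderiv ℝ (fun x => β x / L x) z k := by
  rw [(h.ratio_eventuallyEq hz).fderiv_eq,
    fderiv_mul_apply (h.smooth_ratio z hz) (h.smoothL z hz)]

theorem d2_beta (h : IsGradientChange D L β G G') {z : V × V} (hz : z ∈ D) (k l : V × V) :
    d2 β z k l = β z / L z * d2 L z k l
      + fderiv ℝ (fun x => β x / L x) z k * fderiv ℝ L z l
      + L z * d2 (fun x => β x / L x) z k l
      + fderiv ℝ L z k * fderiv ℝ (fun x => β x / L x) z l := by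
  rw [d2, (h.ratio_eventuallyEq hz).fderiv.fderiv_eq]
  exact d2_mul_apply h.spray.isOpen h.smooth_ratio h.smoothL hz k l

theorem fderiv_energy (h : IsGradientChange D L β G G') {z : V × V} (hz : z ∈ D) (k : V × V) :
    fderiv ℝ (fun x => 1 / 2 * (L x * L x)) z k = L z * fderiv ℝ L z k := by
  rw [fderiv_mul_apply contDiffAt_const (h.smooth_square z hz),
    fderiv_mul_apply (h.smoothL z hz) (h.smoothL z hz)]
  simp
  ring

theorem d2_energy (h : IsGradientChange D L β G G') {z : V × V} (hz : z ∈ D) (k l : V × V) :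
    d2 (fun x => 1 / 2 * (L x * L x)) z k l
      = L z * d2 L z k l + fderiv ℝ L z k * fderiv ℝ L z l := by
  rw [d2_mul_apply h.spray.isOpen (fun _ _ => contDiffAt_const) h.smooth_square hz,
    d2_mul_apply h.spray.isOpen h.smoothL h.smoothL hz]
  have hc : d2 (fun _ : V × V => (1 / 2 : ℝ)) z = 0 := by
    simp only [d2, fderiv_fun_const]
    rw [fderiv_zero, Pi.zero_apply]
  rw [hc]
  simp
  ring

theorem fderiv_energy' (h : IsGradientChange D L β G G') {z : V × V} (hz : z ∈ D) (k : V × V) :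
    fderiv ℝ (fun x => 1 / 2 * (L x * L x) * Real.exp (2 * (β x / L x))) z k
      = Real.exp (2 * (β z / L z)) *
        (L z * fderiv ℝ L z k + L z ^ 2 * fderiv ℝ (fun x => β x / L x) z k) := by
  rw [fderiv_mul_apply (h.spray.smoothE z hz) (smooth_exp (h.smooth_ratio z hz)),
    fderiv_exp_apply (h.smooth_ratio z hz), h.fderiv_energy hz]
  ring

theorem d2_energy' (h : IsGradientChange D L β G G') {z : V × V} (hz : z ∈ D) (k l : V × V) :
    d2 (fun x => 1 / 2 * (L x * L x) * Real.exp (2 * (β x / L x))) z k l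
      = Real.exp (2 * (β z / L z)) *
        (2 * fderiv ℝ (fun x => β x / L x) z k *
            (L z * fderiv ℝ L z l + L z ^ 2 * fderiv ℝ (fun x => β x / L x) z l)
          + L z * d2 L z k l + fderiv ℝ L z k * fderiv ℝ L z l
          + 2 * L z * fderiv ℝ L z k * fderiv ℝ (fun x => β x / L x) z l
          + L z ^ 2 * d2 (fun x => β x / L x) z k l) := by
  rw [d2_mul_apply h.spray.isOpen h.spray.smoothE (fun x hx => smooth_exp (h.smooth_ratio x hx)) hz,
    d2_exp_apply h.spray.isOpen h.smooth_ratio hz, fderiv_exp_apply (h.smooth_ratio z hz),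
    fderiv_exp_apply (h.smooth_ratio z hz), h.fderiv_energy hz, h.fderiv_energy hz,
    h.d2_energy hz]
  ring

theorem fderiv_L_spray (h : IsGradientChange D L β G G') {z : V × V} (hz : z ∈ D) :
    fderiv ℝ L z (z.2, (-2 : ℝ) • G z) = 0 := by
  have := h.spray.energy_spray hz
  rw [h.fderiv_energy hz] at this
  exact (mul_eq_zero.1 this).resolve_left (h.pos z hz).ne'

theorem pair_spray (a b w : V) (B : V × V →L[ℝ] V × V →L[ℝ] ℝ) :
    B (a, (-2 : ℝ) • b) (0, w) = B (a, 0) (0, w) - 2 * B (0, b) (0, w) := by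
  rw [pair_eq, vert_smul, map_add, map_smul, add_apply, smul_apply, smul_eq_mul]
  ring

theorem d2_L_spray (h : IsGradientChange D L β G G') {z : V × V} (hz : z ∈ D) (w : V) :
    d2 L z (z.2, (-2 : ℝ) • G z) (0, w) = fderiv ℝ L z (w, 0) := by
  have h1 := h.spray.spray z hz w
  have h2 : d2 (fun x => 1 / 2 * (L x * L x)) z (z.2, (-2 : ℝ) • G z) (0, w)
      = fderiv ℝ (fun x => 1 / 2 * (L x * L x)) z (w, 0) := by
    rw [pair_spray]
    linarith
  rw [h.d2_energy hz, h.fderiv_energy hz, h.fderiv_L_spray hz, zero_mul, add_zero] at h2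
  exact mul_left_cancel₀ (h.pos z hz).ne' h2

/-- The Euler–Lagrange expression of `τ = β/L` along the spray. -/
theorem d2_ratio_spray (h : IsGradientChange D L β G G') {z : V × V} (hz : z ∈ D) (w : V) :
    L z * (d2 (fun x => β x / L x) z (z.2, (-2 : ℝ) • G z) (0, w)
        - fderiv ℝ (fun x => β x / L x) z (w, 0))
      = -(fderiv ℝ (fun x => β x / L x) z (z.2, (-2 : ℝ) • G z) * fderiv ℝ L z (0, w)) := by
  have h1 := h.gradient z hz w
  rw [h.d2_beta hz, h.fderiv_beta hz, h.fderiv_L_spray hz, h.d2_L_spray hz] at h1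
  linarith

/-- The difference of the two sprays. The gradient condition removes all derivatives of `β` except
the one along the spray. -/
theorem spray_sub (h : IsGradientChange D L β G G') {z : V × V} (hz : z ∈ D) (w : V) :
    2 * d2 (fun x => 1 / 2 * (L x * L x) * Real.exp (2 * (β x / L x))) z (0, G' z - G z) (0, w)
      = fderiv ℝ (fun x => β x / L x) z (z.2, (-2 : ℝ) • G z) *
        (2 * fderiv ℝ (fun x => 1 / 2 * (L x * L x) * Real.exp (2 * (β x / L x))) z (0, w)
          - Real.exp (2 * (β z / L z)) * fderiv ℝ (fun x => 1 / 2 * (L x * L x)) z (0, w)) := by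
  have h1 := h.spray'.spray z hz w
  have h2 := pair_spray z.2 (G z) w
    (d2 (fun x => 1 / 2 * (L x * L x) * Real.exp (2 * (β x / L x))) z)
  rw [h.d2_energy' hz, h.fderiv_L_spray hz, h.d2_L_spray hz] at h2
  have h3 := h.d2_ratio_spray hz w
  rw [h.fderiv_energy' hz] at h1
  rw [vert_sub, map_sub, sub_apply, h.fderiv_energy' hz, h.fderiv_energy hz]
  linear_combination h1 - h2 + Real.exp (2 * (β z / L z)) * L z * h3

theorem fderiv_L_normal (h : IsGradientChange D L β G G')
    (hN : IsNormalField D (fun x => 1 / 2 * (L x * L x)) T p N) {q : K × K} (hq : q ∈ T) :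
    fderiv ℝ L (tangentLift p q) (0, N q) = 0 := by
  have := hN.energy_normal h.spray hq
  rw [h.fderiv_energy (hN.mem q hq)] at this
  exact (mul_eq_zero.1 this).resolve_left (h.pos _ (hN.mem q hq)).ne'

theorem fderiv_ratio_normal (h : IsGradientChange D L β G G')
    (hN : IsNormalField D (fun x => 1 / 2 * (L x * L x)) T p N)
    (hβ : ∀ q ∈ T, fderiv ℝ β (tangentLift p q) (0, N q) = 0) {q : K × K} (hq : q ∈ T) :
    fderiv ℝ (fun x => β x / L x) (tangentLift p q) (0, N q) = 0 := by
  have := hβ q hq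
  rw [h.fderiv_beta (hN.mem q hq), h.fderiv_L_normal hN hq, mul_zero, zero_add] at this
  exact (mul_eq_zero.1 this).resolve_left (h.pos _ (hN.mem q hq)).ne'

/-- Both metrics have the same normal directions. -/
theorem isNormalField (h : IsGradientChange D L β G G')
    (hN : IsNormalField D (fun x => 1 / 2 * (L x * L x)) T p N)
    (hβ : ∀ q ∈ T, fderiv ℝ β (tangentLift p q) (0, N q) = 0)
    (hβ2 : ∀ q ∈ T, ∀ a, d2 β (tangentLift p q) (0, N q) (0, fderiv ℝ p q.1 a) = 0) :
    IsNormalField D (fun x => 1 / 2 * (L x * L x) * Real.exp (2 * (β x / L x))) T p N :=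
  { hN with
    orthogonal := fun q hq a => by
      have hz := hN.mem q hq
      have h1 := hN.orthogonal q hq a
      have h2 := hβ2 q hq a
      have h3 := h.fderiv_L_normal hN hq
      have h4 := h.fderiv_ratio_normal hN hβ hq
      rw [h.d2_energy hz, h3, zero_mul, add_zero] at h1
      have h5 := (mul_eq_zero.1 h1).resolve_left (h.pos _ hz).ne'
      rw [h.d2_beta hz, h3, h4, h5] at h2
      rw [h.d2_energy' hz, h3, h4, h5]
      linear_combination Real.exp (2 * (β (tangentLift p q) / L (tangentLift p q)))
        * L (tangentLift p q) * h2 }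

/-- `S τ` has no normal derivative. The spray is tangent to the set of supporting elements of the
hypersurface, and along it the direction of the normal is parallel; this is used to differentiate
`τ'(0, N) = 0`. -/
theorem fderiv_spray_ratio_normal (h : IsGradientChange D L β G G')
    (hN : IsNormalField D (fun x => 1 / 2 * (L x * L x)) T p N)
    (hβ : ∀ q ∈ T, fderiv ℝ β (tangentLift p q) (0, N q) = 0)
    (ht : IsHorizontallyTangent G T p)
    (hl : HasZeroLandsberg (fun x => 1 / 2 * (L x * L x)) G T p N) {q : K × K} (hq : q ∈ T) :
    fderiv ℝ (fun z => fderiv ℝ (fun x => β x / L x) z (z.2, (-2 : ℝ) • G z)) (tangentLift p q)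
      (0, N q) = 0 := by
  have hz := hN.mem q hq
  have hG := h.spray.smoothG _ hz
  have hτ := h.smooth_ratio _ hz
  have h1 := h.fderiv_ratio_normal hN hβ hq
  have h2 := h.fderiv_L_normal hN hq
  have h3 := h.d2_ratio_spray hz (N q)
  rw [h2, mul_zero, neg_zero] at h3
  have h4 := (mul_eq_zero.1 h3).resolve_left (h.pos _ hz).ne'
  obtain ⟨w, hw⟩ := ht q hq q.2
  obtain ⟨c, hc⟩ := hN.normal_of_hasZeroLandsberg h.spray ht hl hq hw
  have e : fderiv ℝ p q.1 q.2 = (tangentLift p q).2 := rfl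
  rw [e, h.spray.d2_spray_vert_self hz, ← eq_sub_iff_add_eq] at hc
  rw [e, h.spray.fderiv_spray_self hz, ← neg_smul] at hw
  obtain ⟨T', hT, hT'⟩ := hasFDerivAt_tangentLift (hN.smooth_param q hq)
  set τ : V × V → ℝ := fun x => β x / L x with hτdef
  have hg : HasFDerivAt (fun x => fderiv ℝ τ (tangentLift p x)) ((d2 τ (tangentLift p q)).comp T') q :=
    HasFDerivAt.comp (g := fderiv ℝ τ) q (hasFDerivAt_fderiv hτ) hT
  have h5 := hasFDerivAt_apply_eq (hg.clm_apply ((hasFDerivAt_const (0 : V) q).prodMk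
      (hasFDerivAt_of_smooth (hN.smooth_normal q hq)))) (hasFDerivAt_const (0 : ℝ) q)
    ((hN.eventually_mem hq).mono fun x hx => h.fderiv_ratio_normal hN hβ hx) (q.2, w)
  simp only [add_apply, ContinuousLinearMap.comp_apply, ContinuousLinearMap.flip_apply,
    ContinuousLinearMap.prod_apply, zero_apply, hT', hw, hc, e, vert_sub, vert_smul, map_sub,
    map_smul, h1, smul_zero, zero_sub] at h5
  have h6 : HasFDerivAt (fun z => fderiv ℝ τ z (z.2, (-2 : ℝ) • G z)) _ (tangentLift p q) :=
    (hasFDerivAt_fderiv hτ).clm_apply (hasFDerivAt_snd.prodMk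
      ((hasFDerivAt_of_smooth hG).const_smul (-2 : ℝ)))
  rw [h6.fderiv]
  simp only [add_apply, ContinuousLinearMap.comp_apply, ContinuousLinearMap.flip_apply,
    ContinuousLinearMap.prod_apply, ContinuousLinearMap.coe_snd', smul_apply]
  rw [d2_symm hτ, pair_eq (N q), map_add, vert_smul, map_smul, smul_eq_mul]
  linarith

/-- A totally geodesic hypersurface along which `M_αβ` and the Landsberg tensor vanish remains one
under the change of metric. -/
theorem hyperplane (h : IsGradientChange D L β G G')
    (hN : IsNormalField D (fun x => 1 / 2 * (L x * L x)) T p N)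
    (hβ : ∀ q ∈ T, fderiv ℝ β (tangentLift p q) (0, N q) = 0)
    (hβ2 : ∀ q ∈ T, ∀ a, d2 β (tangentLift p q) (0, N q) (0, fderiv ℝ p q.1 a) = 0)
    (ht : IsHorizontallyTangent G T p)
    (hl : HasZeroLandsberg (fun x => 1 / 2 * (L x * L x)) G T p N)
    (hM : HasZeroCartan (fun x => 1 / 2 * (L x * L x)) T p N) :
    IsHorizontallyTangent G' T p ∧
      HasZeroLandsberg (fun x => 1 / 2 * (L x * L x) * Real.exp (2 * (β x / L x))) G' T p N ∧
      HasZeroCartan (fun x => 1 / 2 * (L x * L x) * Real.exp (2 * (β x / L x))) T p N :=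
  hyperplane_transfer h.spray h.spray' hN (h.isNormalField hN hβ hβ2)
    (σ := fun z => fderiv ℝ (fun x => β x / L x) z (z.2, (-2 : ℝ) • G z))
    (μ := fun z => Real.exp (2 * (β z / L z)))
    (fun z hz => (smooth_fderiv (h.smooth_ratio z hz)).clm_apply
      (contDiffAt_snd.prodMk ((h.spray.smoothG z hz).const_smul (-2 : ℝ))))
    (fun z hz => smooth_exp (h.smooth_ratio z hz)) (fun z hz w => h.spray_sub hz w)
    (fun q hq => h.fderiv_spray_ratio_normal hN hβ ht hl hq)
    (fun q hq => by
      rw [fderiv_exp_apply (h.smooth_ratio _ (hN.mem q hq)), h.fderiv_ratio_normal hN hβ hq]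
      simp) ht hl hM

end IsGradientChange

end Change

/-! ### Fundamental functions in coordinates -/

section Coordinates

variable {n : ℕ}

/-- The energy `½ L²`. -/
noncomputable abbrev energy (L : Coord n × Coord n → ℝ) (z : Coord n × Coord n) : ℝ :=
  1 / 2 * (L z * L z)

/-- The spray coefficients `G^i` as a vector. -/
noncomputable def sprayVec (L : Coord n × Coord n → ℝ) (z : Coord n × Coord n) : Coord n :=
  WithLp.toLp 2 fun i => spray L i z

theorem coord_eq_sum (x : Coord n) : x = ∑ i, x i • basisVec i := by
  ext j
  simp [Finset.sum_apply, Pi.single_apply]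

theorem linear_expand {F : Type*} [NormedAddCommGroup F] [NormedSpace ℝ F]
    (f : Coord n →L[ℝ] F) (x : Coord n) : f x = ∑ i, x i • f (basisVec i) := by
  conv_lhs => rw [coord_eq_sum x]
  simp only [map_sum, map_smul]

theorem vert_expand {F : Type*} [NormedAddCommGroup F] [NormedSpace ℝ F]
    (f : Coord n × Coord n →L[ℝ] F) (x : Coord n) : f (0, x) = ∑ i, x i • f (0, basisVec i) := by
  simpa using linear_expand (f.comp (ContinuousLinearMap.inr ℝ (Coord n) (Coord n))) x

theorem hor_expand {F : Type*} [NormedAddCommGroup F] [NormedSpace ℝ F]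
    (f : Coord n × Coord n →L[ℝ] F) (x : Coord n) : f (x, 0) = ∑ i, x i • f (basisVec i, 0) := by
  simpa using linear_expand (f.comp (ContinuousLinearMap.inl ℝ (Coord n) (Coord n))) x

theorem vert_expand₂ (B : Coord n × Coord n →L[ℝ] Coord n × Coord n →L[ℝ] ℝ) (x y : Coord n) :
    B (0, x) (0, y) = ∑ i, ∑ j, B (0, basisVec i) (0, basisVec j) * x i * y j := by
  rw [vert_expand B x, sum_apply]
  refine Finset.sum_congr rfl fun i _ => ?_
  rw [smul_apply, vert_expand _ y, smul_eq_mul, Finset.mul_sum]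
  exact Finset.sum_congr rfl fun j _ => by rw [smul_eq_mul]; ring

theorem fderiv_fderiv_apply {V F : Type*} [NormedAddCommGroup V] [NormedSpace ℝ V]
    [NormedAddCommGroup F] [NormedSpace ℝ F] {f : V → F} {z : V} (hf : ContDiffAt ℝ ∞ f z)
    (k l : V) : fderiv ℝ (fun w => fderiv ℝ f w l) z k = d2 f z k l := by
  rw [((hasFDerivAt_fderiv hf).clm_apply (hasFDerivAt_const l z)).fderiv]
  simp

theorem fderiv_d2_apply {V F : Type*} [NormedAddCommGroup V] [NormedSpace ℝ V]
    [NormedAddCommGroup F] [NormedSpace ℝ F] {f : V → F} {z : V} (hf : ContDiffAt ℝ ∞ f z)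
    (k l m : V) : fderiv ℝ (fun w => d2 f w l m) z k = d3 f z k l m := by
  rw [(((hasFDerivAt_d2 hf).clm_apply (hasFDerivAt_const l z)).clm_apply
    (hasFDerivAt_const m z)).fderiv]
  simp

section Matrix

variable {V : Type*} [NormedAddCommGroup V] [NormedSpace ℝ V] {m : ℕ}

theorem smooth_det {A : V → Matrix (Fin m) (Fin m) ℝ} {z : V}
    (hA : ∀ i j, ContDiffAt ℝ ∞ (fun x => A x i j) z) : ContDiffAt ℝ ∞ (fun x => (A x).det) z := by
  simp only [Matrix.det_apply']
  exact ContDiffAt.sum fun σ _ => contDiffAt_const.mul (contDiffAt_prod fun i _ => hA _ _)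

theorem smooth_adjugate {A : V → Matrix (Fin m) (Fin m) ℝ} {z : V}
    (hA : ∀ i j, ContDiffAt ℝ ∞ (fun x => A x i j) z) (i j : Fin m) :
    ContDiffAt ℝ ∞ (fun x => (A x).adjugate i j) z := by
  simp only [Matrix.adjugate_apply]
  refine smooth_det fun k l => ?_
  by_cases hk : k = j
  · subst hk
    simpa only [Matrix.updateRow_self] using contDiffAt_const
  · simpa only [Matrix.updateRow_ne hk] using hA k l

theorem smooth_inv {A : V → Matrix (Fin m) (Fin m) ℝ} {z : V}
    (hA : ∀ i j, ContDiffAt ℝ ∞ (fun x => A x i j) z) (hd : (A z).det ≠ 0) (i j : Fin m) :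
    ContDiffAt ℝ ∞ (fun x => (A x)⁻¹ i j) z := by
  simp only [Matrix.inv_def, Ring.inverse_eq_inv', Matrix.smul_apply, smul_eq_mul]
  exact ((smooth_det hA).inv hd).mul (smooth_adjugate hA i j)

end Matrix

namespace IsFundamental

variable {D : Set (Coord n × Coord n)} {L : Coord n × Coord n → ℝ} {z : Coord n × Coord n}

theorem contDiffAt (h : IsFundamental D L) (hz : z ∈ D) : ContDiffAt ℝ ∞ L z :=
  h.smooth.contDiffAt (h.isOpen.mem_nhds hz)

theorem contDiffAt_energy (h : IsFundamental D L) (hz : z ∈ D) : ContDiffAt ℝ ∞ (energy L) z :=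
  contDiffAt_const.mul ((h.contDiffAt hz).mul (h.contDiffAt hz))

theorem fderiv_energy (h : IsFundamental D L) (hz : z ∈ D) (k : Coord n × Coord n) :
    fderiv ℝ (energy L) z k = L z * fderiv ℝ L z k := by
  rw [fderiv_mul_apply contDiffAt_const ((h.contDiffAt hz).mul (h.contDiffAt hz)),
    fderiv_mul_apply (h.contDiffAt hz) (h.contDiffAt hz)]
  simp
  ring

theorem fderiv_sq (L : Coord n × Coord n → ℝ) :
    fderiv ℝ (fun w => L w ^ 2) = (2 : ℝ) • fderiv ℝ (energy L) := by
  rw [← fderiv_const_smul_field]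
  congr 1
  ext w
  simp [energy]
  ring

theorem metric_eq (h : IsFundamental D L) (hz : z ∈ D) (i j : Fin n) :
    metric L z i j = d2 (energy L) z (0, basisVec i) (0, basisVec j) := by
  have : dY j (fun w => L w ^ 2) = (2 : ℝ) • fun w => fderiv ℝ (energy L) w (0, basisVec j) := by
    ext w
    rw [dY, fderiv_sq]
    rfl
  rw [metric, Matrix.of_apply, this, dY, fderiv_const_smul_field, Pi.smul_apply, smul_apply,
    fderiv_fderiv_apply (h.contDiffAt_energy hz), smul_eq_mul]
  ring

theorem metric_eventuallyEq (h : IsFundamental D L) (hz : z ∈ D) (i j : Fin n) :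
    (fun w => metric L w i j)
      =ᶠ[nhds z] fun w => d2 (energy L) w (0, basisVec i) (0, basisVec j) :=
  Filter.mem_of_superset (h.isOpen.mem_nhds hz) fun _ hx => h.metric_eq hx i j

theorem smooth_metric (h : IsFundamental D L) (hz : z ∈ D) (i j : Fin n) :
    ContDiffAt ℝ ∞ (fun w => metric L w i j) z :=
  ContDiffAt.congr_of_eventuallyEq (((smooth_fderiv (smooth_fderiv
    (h.contDiffAt_energy hz))).clm_apply contDiffAt_const).clm_apply contDiffAt_const)
    (h.metric_eventuallyEq hz i j)

theorem fderiv_metric (h : IsFundamental D L) (hz : z ∈ D) (i j : Fin n)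
    (k : Coord n × Coord n) : fderiv ℝ (fun w => metric L w i j) z k
      = d3 (energy L) z k (0, basisVec i) (0, basisVec j) := by
  rw [(h.metric_eventuallyEq hz i j).fderiv_eq, fderiv_d2_apply (h.contDiffAt_energy hz)]

theorem metric_symm (h : IsFundamental D L) (hz : z ∈ D) (i j : Fin n) :
    metric L z i j = metric L z j i := by
  rw [h.metric_eq hz, d2_symm (h.contDiffAt_energy hz), h.metric_eq hz]

theorem sum_metric (h : IsFundamental D L) (hz : z ∈ D) (x y : Coord n) :
    ∑ i, ∑ j, metric L z i j * x i * y j = d2 (energy L) z (0, x) (0, y) := by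
  rw [vert_expand₂]
  simp only [h.metric_eq hz]

theorem metric_mul_inv (h : IsFundamental D L) (hz : z ∈ D) (i k : Fin n) :
    ∑ j, metric L z i j * metricInv L z j k = if i = k then 1 else 0 := by
  have := congrFun (congrFun (Matrix.mul_nonsing_inv (metric L z) (h.regular z hz).isUnit) i) k
  rwa [Matrix.mul_apply, Matrix.one_apply] at this

theorem smooth_spray (h : IsFundamental D L) (hz : z ∈ D) (i : Fin n) :
    ContDiffAt ℝ ∞ (spray L i) z := by
  have hE := h.contDiffAt_energy hz
  have h1 : ∀ j, ContDiffAt ℝ ∞ (dY j fun w => L w ^ 2) z := fun j => by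
    change ContDiffAt ℝ ∞ (fun z => fderiv ℝ (fun w => L w ^ 2) z (0, basisVec j)) z
    rw [fderiv_sq]
    exact ((smooth_fderiv hE).const_smul (2 : ℝ)).clm_apply contDiffAt_const
  have h2 : ∀ j, ContDiffAt ℝ ∞ (dX j fun w => L w ^ 2) z := fun j => by
    change ContDiffAt ℝ ∞ (fun z => fderiv ℝ (fun w => L w ^ 2) z (basisVec j, 0)) z
    rw [fderiv_sq]
    exact ((smooth_fderiv hE).const_smul (2 : ℝ)).clm_apply contDiffAt_const
  have h3 : ∀ k j, ContDiffAt ℝ ∞ (dX k (dY j fun w => L w ^ 2)) z := fun k j =>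
    (smooth_fderiv (h1 j)).clm_apply contDiffAt_const
  have h4 : ∀ k, ContDiffAt ℝ ∞ (fun z : Coord n × Coord n => z.2 k) z := fun k =>
    (EuclideanSpace.proj (𝕜 := ℝ) k).contDiff.contDiffAt.comp z contDiffAt_snd
  exact contDiffAt_const.mul (ContDiffAt.sum fun r _ =>
    (smooth_inv (fun i j => h.smooth_metric hz i j) (h.regular z hz) i r).mul
      ((ContDiffAt.sum fun k _ => (h4 k).mul (h3 k r)).sub (h2 r)))

theorem spray_equation (h : IsFundamental D L) (hz : z ∈ D) (w : Coord n) :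
    2 * d2 (energy L) z (0, sprayVec L z) (0, w)
      = d2 (energy L) z (z.2, 0) (0, w) - fderiv ℝ (energy L) z (w, 0) := by
  have hE := h.contDiffAt_energy hz
  have key : ∀ r, 2 * d2 (energy L) z (0, sprayVec L z) (0, basisVec r)
      = d2 (energy L) z (z.2, 0) (0, basisVec r) - fderiv ℝ (energy L) z (basisVec r, 0) := by
    intro r
    have h1 : ∀ k s, dX k (dY s fun w => L w ^ 2) z
        = 2 * d2 (energy L) z (basisVec k, 0) (0, basisVec s) := fun k s => by
      have : dY s (fun w => L w ^ 2)
          = (2 : ℝ) • fun w => fderiv ℝ (energy L) w (0, basisVec s) := by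
        ext w
        rw [dY, fderiv_sq]
        rfl
      rw [this, dX, fderiv_const_smul_field, Pi.smul_apply, smul_apply, fderiv_fderiv_apply hE,
        smul_eq_mul]
    have h2 : ∀ s, dX s (fun w => L w ^ 2) z = 2 * fderiv ℝ (energy L) z (basisVec s, 0) :=
      fun s => by rw [dX, fderiv_sq]; rfl
    have h3 : ∀ s, ∑ k, z.2 k * dX k (dY s fun w => L w ^ 2) z - dX s (fun w => L w ^ 2) z
        = 2 * (d2 (energy L) z (z.2, 0) (0, basisVec s)
          - fderiv ℝ (energy L) z (basisVec s, 0)) := fun s => by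
      rw [hor_expand _ z.2]
      simp only [h1, h2, sum_apply, smul_apply, smul_eq_mul, mul_sub, Finset.mul_sum]
      congr 1
      exact Finset.sum_congr rfl fun k _ => by ring
    rw [d2_symm hE, vert_expand]
    simp only [sprayVec, spray, h3, smul_eq_mul, ← h.metric_eq hz]
    calc _ = ∑ i, ∑ s, (metric L z r i * metricInv L z i s) *
          (d2 (energy L) z (z.2, 0) (0, basisVec s)
            - fderiv ℝ (energy L) z (basisVec s, 0)) := by
          rw [Finset.mul_sum]
          refine Finset.sum_congr rfl fun i _ => ?_
          rw [Finset.mul_sum, Finset.sum_mul, Finset.mul_sum]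
          exact Finset.sum_congr rfl fun s _ => by ring
      _ = _ := by
          rw [Finset.sum_comm]
          simp only [← Finset.sum_mul, h.metric_mul_inv hz, ite_mul, one_mul, zero_mul,
            Finset.sum_ite_eq, Finset.mem_univ, if_true]
  rw [vert_expand _ w, vert_expand _ w, hor_expand _ w, Finset.mul_sum, ← Finset.sum_sub_distrib]
  refine Finset.sum_congr rfl fun r _ => ?_
  simp only [smul_eq_mul]
  linear_combination w r * key r

theorem nondegenerate (h : IsFundamental D L) (hz : z ∈ D) (x : Coord n)
    (hx : ∀ w, d2 (energy L) z (0, x) (0, w) = 0) : x = 0 := by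
  have : (metric L z).mulVec x = 0 := by
    ext i
    have := hx (basisVec i)
    rw [d2_symm (h.contDiffAt_energy hz), vert_expand] at this
    simp only [← h.metric_eq hz, smul_eq_mul] at this
    rw [Matrix.mulVec, dotProduct, Pi.zero_apply, ← this]
    exact Finset.sum_congr rfl fun j _ => mul_comm _ _
  ext i
  exact congrFun (Matrix.eq_zero_of_mulVec_eq_zero (h.regular z hz) this) i

theorem euler (h : IsFundamental D L) (hz : z ∈ D) :
    fderiv ℝ (energy L) z (0, z.2) = 2 * energy L z := by
  have h1 : HasDerivAt (fun t : ℝ => L (z.1, t • z.2)) (fderiv ℝ L z (0, z.2)) 1 := by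
    have hc : HasDerivAt (fun t : ℝ => (z.1, t • z.2)) (0, z.2) 1 := by
      simpa using (hasDerivAt_const (1 : ℝ) z.1).prodMk ((hasDerivAt_id (1 : ℝ)).smul_const z.2)
    have hz1 : (z.1, (1 : ℝ) • z.2) = z := by simp
    have hL := hasFDerivAt_of_smooth (h.contDiffAt hz)
    rw [← hz1] at hL
    have := hL.comp_hasDerivAt (1 : ℝ) hc
    rwa [hz1] at this
  have h2 : HasDerivAt (fun t : ℝ => t * L z) (L z) 1 := by
    simpa using (hasDerivAt_id (1 : ℝ)).mul_const (L z)
  have h3 : (fun t : ℝ => L (z.1, t • z.2)) =ᶠ[nhds 1] fun t => t * L z :=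
    (lt_mem_nhds one_pos).mono fun t ht => h.homogeneous z hz t ht
  rw [h.fderiv_energy hz, h1.unique (h2.congr_of_eventuallyEq h3)]
  ring

theorem isSpray (h : IsFundamental D L) : IsSpray D (energy L) (sprayVec L) where
  isOpen := h.isOpen
  smoothE _ hz := h.contDiffAt_energy hz
  smoothG z hz := by
    rw [contDiffAt_euclidean]
    exact fun i => h.smooth_spray hz i
  euler _ hz := h.euler hz
  nondegenerate _ hz := h.nondegenerate hz
  spray _ hz := h.spray_equation hz

theorem nonlin_eq (h : IsFundamental D L) (hz : z ∈ D) (i j : Fin n) :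
    nonlin L i j z = fderiv ℝ (sprayVec L) z (0, basisVec j) i := by
  have h1 : HasFDerivAt (spray L i)
      ((EuclideanSpace.proj (𝕜 := ℝ) i).comp (fderiv ℝ (sprayVec L) z)) z :=
    (EuclideanSpace.proj (𝕜 := ℝ) i).hasFDerivAt.comp z
      (hasFDerivAt_of_smooth (h.isSpray.smoothG z hz))
  rw [nonlin, dY, h1.fderiv]
  rfl

theorem delta_eq (h : IsFundamental D L) (hz : z ∈ D) (f : Coord n × Coord n → ℝ) (j : Fin n) :
    delta L j f z
      = fderiv ℝ f z (basisVec j, -fderiv ℝ (sprayVec L) z (0, basisVec j)) := by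
  rw [pair_eq, vert_neg, map_add, map_neg, vert_expand _ (fderiv ℝ (sprayVec L) z _), delta,
    sub_eq_add_neg]
  simp only [h.nonlin_eq hz, dX, dY, smul_eq_mul]

theorem cartan_eq (h : IsFundamental D L) (hz : z ∈ D) (i j k : Fin n) :
    cartan L i j k z
      = 1 / 2 * d3 (energy L) z (0, basisVec i) (0, basisVec j) (0, basisVec k) := by
  rw [cartan, dY, h.fderiv_metric hz]

theorem angular_eq (h : IsFundamental D L) (hz : z ∈ D) (i j : Fin n) :
    angular L i j z = d2 (energy L) z (0, basisVec i) (0, basisVec j)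
      - fderiv ℝ L z (0, basisVec i) * fderiv ℝ L z (0, basisVec j) := by
  rw [angular, h.metric_eq hz, dY, dY]

theorem cartanF_symm (h : IsFundamental D L) (hz : z ∈ D) (i j k : Fin n) :
    cartanF L i j k z = cartanF L i k j z := by
  have hE := h.contDiffAt_energy hz
  simp only [cartanF, h.delta_eq hz, h.fderiv_metric hz]
  congr 1
  refine Finset.sum_congr rfl fun r _ => ?_
  rw [d3_symm_right hE _ (0, basisVec r) (0, basisVec k),
    d3_symm_right hE _ (0, basisVec j) (0, basisVec r),
    d3_symm_right hE _ (0, basisVec j) (0, basisVec k)]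
  ring

end IsFundamental

end Coordinates

/-! ### Hypersurfaces in coordinates -/

section HypersurfaceCoordinates

variable {n m : ℕ}

theorem sum_rotate (f : Fin n → Fin n → Fin n → ℝ) :
    ∑ j, ∑ k, ∑ r, f j k r = ∑ r, ∑ j, ∑ k, f j k r := by
  rw [Finset.sum_comm (s := Finset.univ (α := Fin n)) (f := fun r j => ∑ k, f j k r)]
  exact Finset.sum_congr rfl fun j _ => Finset.sum_comm

theorem trilinear_expand
    (B : Coord n →L[ℝ] Coord n × Coord n →L[ℝ] Coord n × Coord n →L[ℝ] ℝ) (x y w : Coord n) :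
    B x (0, y) (0, w)
      = ∑ i, ∑ j, ∑ k, (x i * y j * w k) • B (basisVec i) (0, basisVec j) (0, basisVec k) := by
  have hx := linear_expand ((B.flip (0, y)).flip (0, w)) x
  simp only [ContinuousLinearMap.flip_apply] at hx
  rw [hx]
  refine Finset.sum_congr rfl fun i _ => ?_
  rw [vert_expand (B (basisVec i)) y, sum_apply, Finset.smul_sum]
  refine Finset.sum_congr rfl fun j _ => ?_
  rw [smul_apply, vert_expand _ w, Finset.smul_sum, Finset.smul_sum]
  exact Finset.sum_congr rfl fun k _ => by simp only [smul_smul, mul_assoc]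

theorem proj2_eq {p : Coord m → Coord n} {u : Coord m} (hp : ContDiffAt ℝ ∞ p u) (i : Fin n)
    (a b : Fin m) : proj2 p i a b u = d2 p u (basisVec a) (basisVec b) i := by
  have h1 : HasFDerivAt (fun x => proj p i a x) _ u :=
    (EuclideanSpace.proj (𝕜 := ℝ) i).hasFDerivAt.comp u
      ((hasFDerivAt_fderiv hp).clm_apply (hasFDerivAt_const (basisVec a) u))
  rw [proj2, show proj p i a = fun x => proj p i a x from rfl, h1.fderiv, d2_symm hp]
  simp

namespace IsFundamental

variable {D : Set (Coord n × Coord n)} {L : Coord n × Coord n → ℝ} {z : Coord n × Coord n}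

theorem sum_cartan (h : IsFundamental D L) (hz : z ∈ D) (x y w : Coord n) :
    ∑ i, ∑ j, ∑ k, cartan L i j k z * x i * y j * w k
      = 1 / 2 * d3 (energy L) z (0, x) (0, y) (0, w) := by
  have := trilinear_expand
    ((d3 (energy L) z).comp (ContinuousLinearMap.inr ℝ (Coord n) (Coord n))) x y w
  simp only [ContinuousLinearMap.comp_apply, ContinuousLinearMap.inr_apply] at this
  simp only [this, h.cartan_eq hz, Finset.mul_sum, smul_eq_mul]
  exact Finset.sum_congr rfl fun i _ => Finset.sum_congr rfl fun j _ =>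
    Finset.sum_congr rfl fun k _ => by ring

theorem sum_metric_mul_inv (h : IsFundamental D L) (hz : z ∈ D) (x f : Fin n → ℝ) :
    ∑ i, (∑ l, metric L z i l * x l) * ∑ r, metricInv L z i r * f r = ∑ r, x r * f r := by
  calc _ = ∑ i, ∑ r, ∑ l, x l * f r * (metric L z l i * metricInv L z i r) := by
        refine Finset.sum_congr rfl fun i _ => ?_
        rw [Finset.sum_mul_sum, Finset.sum_comm]
        refine Finset.sum_congr rfl fun r _ => Finset.sum_congr rfl fun l _ => ?_
        rw [h.metric_symm hz i l]
        ring
    _ = ∑ r, ∑ l, ∑ i, x l * f r * (metric L z l i * metricInv L z i r) := by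
        rw [Finset.sum_comm]
        exact Finset.sum_congr rfl fun r _ => Finset.sum_comm
    _ = _ := by
        simp only [← Finset.mul_sum, h.metric_mul_inv hz, mul_ite, mul_one, mul_zero,
          Finset.sum_ite_eq', Finset.mem_univ, if_true]

/-- The horizontal coefficients of the Cartan connection, lowered with the metric tensor. -/
theorem sum_cartanF (h : IsFundamental D L) (hz : z ∈ D) (x y w : Coord n) :
    ∑ i, (∑ l, metric L z i l * w l) * ∑ j, ∑ k, cartanF L i j k z * x j * y k = 1 / 2 *
      (d3 (energy L) z (x, -fderiv ℝ (sprayVec L) z (0, x)) (0, w) (0, y)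
        + d3 (energy L) z (y, -fderiv ℝ (sprayVec L) z (0, y)) (0, x) (0, w)
        - d3 (energy L) z (w, -fderiv ℝ (sprayVec L) z (0, w)) (0, x) (0, y)) := by
  let H : Coord n →L[ℝ] Coord n × Coord n := (ContinuousLinearMap.id ℝ (Coord n)).prod
    (-((fderiv ℝ (sprayVec L) z).comp (ContinuousLinearMap.inr ℝ (Coord n) (Coord n))))
  have e := trilinear_expand ((d3 (energy L) z).comp H)
  have hH : ∀ x, H x = (x, -fderiv ℝ (sprayVec L) z (0, x)) := fun x => rfl
  simp only [ContinuousLinearMap.comp_apply, hH] at e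
  rw [e x w y, e y x w, e w x y]
  simp only [cartanF, h.delta_eq hz, h.fderiv_metric hz]
  set B : Fin n → Fin n → Fin n → ℝ := fun i j k => d3 (energy L) z
    (basisVec i, -fderiv ℝ (sprayVec L) z (0, basisVec i)) (0, basisVec j) (0, basisVec k)
  calc _ = ∑ i, (∑ l, metric L z i l * w l) * ∑ r, metricInv L z i r *
          (1 / 2 * ∑ j, ∑ k, (B j r k + B k j r - B r j k) * x j * y k) := by
        refine Finset.sum_congr rfl fun i _ => ?_
        congr 1
        simp only [Finset.mul_sum, Finset.sum_mul]
        rw [sum_rotate]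
        exact Finset.sum_congr rfl fun r _ => Finset.sum_congr rfl fun j _ =>
          Finset.sum_congr rfl fun k _ => by ring
    _ = ∑ r, w r * (1 / 2 * ∑ j, ∑ k, (B j r k + B k j r - B r j k) * x j * y k) :=
        h.sum_metric_mul_inv hz _ _
    _ = _ := by
        have e1 : ∑ i, ∑ j, ∑ k, (x i * w j * y k) • B i j k
            = ∑ r, ∑ j, ∑ k, (x j * w r * y k) • B j r k := Finset.sum_comm
        have e2 : ∑ i, ∑ j, ∑ k, (y i * x j * w k) • B i j k
            = ∑ r, ∑ j, ∑ k, (y k * x j * w r) • B k j r := by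
          rw [sum_rotate]
          refine Finset.sum_congr rfl fun r _ => Finset.sum_comm
        rw [e1, e2, ← Finset.sum_add_distrib, ← Finset.sum_sub_distrib, Finset.mul_sum]
        refine Finset.sum_congr rfl fun r _ => ?_
        simp only [← Finset.sum_add_distrib, ← Finset.sum_sub_distrib, Finset.mul_sum]
        refine Finset.sum_congr rfl fun j _ => Finset.sum_congr rfl fun k _ => ?_
        simp only [smul_eq_mul]
        ring

variable {p : Coord m → Coord n} {u v : Coord m}

theorem isUnitNormal_iff (h : IsFundamental D L) (hz : tangentLift p (u, v) ∈ D)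
    {N : Fin n → ℝ} : IsUnitNormal L p u v N ↔
      (∀ a, d2 (energy L) (tangentLift p (u, v)) (0, WithLp.toLp 2 N)
        (0, fderiv ℝ p u (basisVec a)) = 0) ∧
      d2 (energy L) (tangentLift p (u, v)) (0, WithLp.toLp 2 N) (0, WithLp.toLp 2 N) = 1 := by
  have h1 := h.sum_metric hz
  refine and_congr (forall_congr' fun a => ?_) ?_
  · rw [d2_symm (h.contDiffAt_energy hz), ← h1]
    rfl
  · rw [← h1]
    rfl

theorem tenM_eq (h : IsFundamental D L) (hz : tangentLift p (u, v) ∈ D) (N : Fin n → ℝ)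
    (a b : Fin m) : tenM L p u v N a b = 1 / 2 * d3 (energy L) (tangentLift p (u, v))
      (0, fderiv ℝ p u (basisVec a)) (0, fderiv ℝ p u (basisVec b)) (0, WithLp.toLp 2 N) :=
  h.sum_cartan hz _ _ (WithLp.toLp 2 N)

theorem vecM_eq (h : IsFundamental D L) (hz : tangentLift p (u, v) ∈ D) (N : Fin n → ℝ)
    (a : Fin m) : vecM L p u v N a = 1 / 2 * d3 (energy L) (tangentLift p (u, v))
      (0, fderiv ℝ p u (basisVec a)) (0, WithLp.toLp 2 N) (0, WithLp.toLp 2 N) :=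
  h.sum_cartan hz _ (WithLp.toLp 2 N) (WithLp.toLp 2 N)

theorem sum_conormal (h : IsFundamental D L) (hz : tangentLift p (u, v) ∈ D) (N : Fin n → ℝ)
    (x : Coord n) : ∑ i, conormal L p u v N i * x i
      = d2 (energy L) (tangentLift p (u, v)) (0, WithLp.toLp 2 N) (0, x) := by
  rw [d2_symm (h.contDiffAt_energy hz), ← h.sum_metric hz]
  refine Finset.sum_congr rfl fun i _ => ?_
  rw [conormal, Finset.sum_mul]
  exact Finset.sum_congr rfl fun j _ => by rw [mul_right_comm]; rfl

theorem vecH_eq (h : IsFundamental D L) (hz : tangentLift p (u, v) ∈ D)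
    (hp : ContDiffAt ℝ ∞ p u) (N : Fin n → ℝ) (a : Fin m) :
    vecH L p u v N a = d2 (energy L) (tangentLift p (u, v)) (0, WithLp.toLp 2 N)
      (0, d2 p u (basisVec a) v + fderiv ℝ (sprayVec L) (tangentLift p (u, v))
        (0, fderiv ℝ p u (basisVec a))) := by
  rw [← h.sum_conormal hz, vecH]
  refine Finset.sum_congr rfl fun i _ => ?_
  congr 1
  have e1 : d2 p u (basisVec a) v i = ∑ b, proj2 p i b a u * v b := by
    rw [linear_expand (d2 p u (basisVec a)) v]
    simp [proj2_eq hp, d2_symm hp (basisVec a), mul_comm]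
  have e2 : fderiv ℝ (sprayVec L) (tangentLift p (u, v)) (0, fderiv ℝ p u (basisVec a)) i
      = ∑ j, nonlin L i j (tangentLift p (u, v)) * proj p j a u := by
    rw [vert_expand (fderiv ℝ (sprayVec L) (tangentLift p (u, v)))]
    simp [h.nonlin_eq hz, proj, mul_comm]
  rw [PiLp.add_apply, e1, e2]
  rfl

theorem tenH_eq (h : IsFundamental D L) (hz : tangentLift p (u, v) ∈ D)
    (hp : ContDiffAt ℝ ∞ p u) (N : Fin n → ℝ) (a b : Fin m) :
    tenH L p u v N a b
      = IsNormalField.curvatureTensor (energy L) (sprayVec L) p (fun _ => WithLp.toLp 2 N) (u, v)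
          (basisVec a) (basisVec b)
        + vecM L p u v N a * vecH L p u v N b := by
  rw [tenH, IsNormalField.curvatureTensor]
  simp only [mul_add, Finset.sum_add_distrib]
  congr 2
  · rw [← h.sum_conormal hz]
    simp only [proj2_eq hp]
  · exact h.sum_cartanF hz _ _ (WithLp.toLp 2 N)

end IsFundamental

end HypersurfaceCoordinates

/-! ### `h`-vectors and normal fields in coordinates -/

section HVector

variable {n : ℕ}

/-- The function `β = b_i y^i`. -/
noncomputable def contraction (b : Fin n → Coord n × Coord n → ℝ) (z : Coord n × Coord n) : ℝ :=
  ∑ i, b i z * z.2 i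

/-- The `h`-vector conditions, with the scalar function `ρ`, and the gradient condition, in
coordinates. -/
structure IsGradientHVector (D : Set (Coord n × Coord n)) (L : Coord n × Coord n → ℝ)
    (b : Fin n → Coord n × Coord n → ℝ) (ρ : Coord n × Coord n → ℝ) : Prop where
  smooth : ∀ i, ContDiffOn ℝ ∞ (b i) D
  vCov_eq : ∀ z ∈ D, ∀ i j, vCov L b i j z = 0
  cartan_eq : ∀ z ∈ D, ∀ i j, L z * ∑ h, cartanUp L h i j z * b h z = ρ z * angular L i j z
  gradient : ∀ z ∈ D, ∀ i j, hCov L b i j z = hCov L b j i z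

theorem energy_expChange {L L' β : Coord n × Coord n → ℝ}
    (hL' : ∀ z, L' z = L z * Real.exp (β z / L z)) :
    energy L' = fun x => 1 / 2 * (L x * L x) * Real.exp (2 * (β x / L x)) := by
  ext z
  rw [energy, hL', two_mul (β z / L z), Real.exp_add]
  ring

namespace IsGradientHVector

variable {D : Set (Coord n × Coord n)} {L L' : Coord n × Coord n → ℝ}
  {b : Fin n → Coord n × Coord n → ℝ} {ρ : Coord n × Coord n → ℝ} {z : Coord n × Coord n}

theorem contDiffAt (hb : IsGradientHVector D L b ρ) (h : IsFundamental D L) (hz : z ∈ D)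
    (i : Fin n) : ContDiffAt ℝ ∞ (b i) z :=
  (hb.smooth i).contDiffAt (h.isOpen.mem_nhds hz)

/-- `∂b_i/∂y^j = (ρ/L) h_ij`. -/
theorem fderiv_vert (hb : IsGradientHVector D L b ρ) (h : IsFundamental D L) (hz : z ∈ D)
    (i : Fin n) (w : Coord n) :
    fderiv ℝ (b i) z (0, w) = ρ z / L z *
      (d2 (energy L) z (0, w) (0, basisVec i)
        - fderiv ℝ L z (0, basisVec i) * fderiv ℝ L z (0, w)) := by
  have key : ∀ j, fderiv ℝ (b i) z (0, basisVec j) = ρ z / L z *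
      (d2 (energy L) z (0, basisVec j) (0, basisVec i)
        - fderiv ℝ L z (0, basisVec i) * fderiv ℝ L z (0, basisVec j)) := fun j => by
    have h1 := hb.vCov_eq z hz i j
    have h2 := hb.cartan_eq z hz i j
    rw [h.angular_eq hz, d2_symm (h.contDiffAt_energy hz)] at h2
    rw [vCov, sub_eq_zero, dY] at h1
    rw [h1, div_mul_eq_mul_div, eq_div_iff (h.pos z hz).ne', ← h2, mul_comm]
    congr 1
    exact Finset.sum_congr rfl fun r _ => mul_comm _ _
  rw [vert_expand _ w, vert_expand _ w, vert_expand _ w, sum_apply, Finset.mul_sum,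
    ← Finset.sum_sub_distrib, Finset.mul_sum]
  refine Finset.sum_congr rfl fun j _ => ?_
  rw [key, smul_apply]
  simp only [smul_eq_mul]
  ring

theorem fderiv_contraction (hb : IsGradientHVector D L b ρ) (h : IsFundamental D L) (hz : z ∈ D)
    (k : Coord n × Coord n) : fderiv ℝ (contraction b) z k
      = ∑ i, b i z * k.2 i + ∑ i, z.2 i * fderiv ℝ (b i) z k := by
  have h1 : HasFDerivAt (fun x : Coord n × Coord n => ∑ i, b i x * x.2 i) _ z :=
    HasFDerivAt.fun_sum fun i _ => (hasFDerivAt_of_smooth (hb.contDiffAt h hz i)).mul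
      ((EuclideanSpace.proj (𝕜 := ℝ) i).hasFDerivAt.comp z hasFDerivAt_snd)
  rw [show contraction b = fun x => ∑ i, b i x * x.2 i from rfl, h1.fderiv]
  simp [Finset.sum_add_distrib]

/-- `∂β/∂y^i = b_i`. -/
theorem fderiv_contraction_vert (hb : IsGradientHVector D L b ρ) (h : IsFundamental D L)
    (hz : z ∈ D) (w : Coord n) : fderiv ℝ (contraction b) z (0, w) = ∑ i, b i z * w i := by
  have h1 : ∑ i, z.2 i * fderiv ℝ (b i) z (0, w) = ρ z / L z *
      (d2 (energy L) z (0, w) (0, z.2) - fderiv ℝ L z (0, z.2) * fderiv ℝ L z (0, w)) := by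
    rw [vert_expand _ z.2, vert_expand _ z.2, Finset.sum_mul, ← Finset.sum_sub_distrib,
      Finset.mul_sum]
    refine Finset.sum_congr rfl fun i _ => ?_
    rw [hb.fderiv_vert h hz]
    simp only [smul_eq_mul]
    ring
  have h2 := h.euler hz
  have hL := h.pos z hz
  rw [h.fderiv_energy hz] at h2
  have h3 : fderiv ℝ L z (0, z.2) = L z := mul_left_cancel₀ hL.ne' (by rw [h2, energy]; ring)
  rw [h.isSpray.metric_self hz, h.fderiv_energy hz, h3, sub_self, mul_zero] at h1
  rw [hb.fderiv_contraction h hz, h1, add_zero]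

theorem smooth_contraction (hb : IsGradientHVector D L b ρ) (h : IsFundamental D L)
    (hz : z ∈ D) : ContDiffAt ℝ ∞ (contraction b) z :=
  ContDiffAt.sum fun i _ => (hb.contDiffAt h hz i).mul
    ((EuclideanSpace.proj (𝕜 := ℝ) i).contDiff.contDiffAt.comp z contDiffAt_snd)

theorem d2_contraction (hb : IsGradientHVector D L b ρ) (h : IsFundamental D L)
    (hz : z ∈ D) (k : Coord n × Coord n) (w : Coord n) :
    d2 (contraction b) z k (0, w) = ∑ i, w i * fderiv ℝ (b i) z k := by
  have h1 := (hasFDerivAt_fderiv (hb.smooth_contraction h hz)).clm_apply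
    (hasFDerivAt_const ((0 : Coord n), w) z)
  have h2 : HasFDerivAt (fun x => ∑ i, b i x * w i) _ z :=
    HasFDerivAt.fun_sum fun i _ =>
      (hasFDerivAt_of_smooth (hb.contDiffAt h hz i)).mul_const (w i)
  have := hasFDerivAt_apply_eq h1 h2 (Filter.mem_of_superset (h.isOpen.mem_nhds hz) fun x hx =>
    hb.fderiv_contraction_vert h hx w) k
  rw [add_apply, ContinuousLinearMap.comp_apply, ContinuousLinearMap.flip_apply, zero_apply,
    map_zero, zero_add, sum_apply] at this
  exact this

/-- Since `F^r_ij` is symmetric in `i` and `j`, the gradient condition reads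
`δ_j b_i = δ_i b_j`. -/
theorem gradient_horizontal (hb : IsGradientHVector D L b ρ) (h : IsFundamental D L)
    (hz : z ∈ D) (x w : Coord n) :
    ∑ i, w i * fderiv ℝ (b i) z (x, -fderiv ℝ (sprayVec L) z (0, x))
      = ∑ i, x i * fderiv ℝ (b i) z (w, -fderiv ℝ (sprayVec L) z (0, w)) := by
  let H : Coord n →L[ℝ] Coord n × Coord n := (ContinuousLinearMap.id ℝ (Coord n)).prod
    (-((fderiv ℝ (sprayVec L) z).comp (ContinuousLinearMap.inr ℝ (Coord n) (Coord n))))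
  have hH : ∀ x, H x = (x, -fderiv ℝ (sprayVec L) z (0, x)) := fun x => rfl
  have e : ∀ i x, fderiv ℝ (b i) z (x, -fderiv ℝ (sprayVec L) z (0, x))
      = ∑ j, x j * fderiv ℝ (b i) z (basisVec j, -fderiv ℝ (sprayVec L) z (0, basisVec j)) :=
    fun i x => linear_expand ((fderiv ℝ (b i) z).comp H) x
  have hs : ∀ i j, fderiv ℝ (b i) z (basisVec j, -fderiv ℝ (sprayVec L) z (0, basisVec j))
      = fderiv ℝ (b j) z (basisVec i, -fderiv ℝ (sprayVec L) z (0, basisVec i)) := fun i j => by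
    have := hb.gradient z hz i j
    simp only [hCov, h.delta_eq hz, h.cartanF_symm hz _ i j] at this
    exact sub_left_injective this
  have hexp : ∀ x w : Coord n,
      ∑ i, w i * fderiv ℝ (b i) z (x, -fderiv ℝ (sprayVec L) z (0, x)) = ∑ i, ∑ j, w i *
        (x j * fderiv ℝ (b i) z (basisVec j, -fderiv ℝ (sprayVec L) z (0, basisVec j))) :=
    fun x w => Finset.sum_congr rfl fun i _ => by rw [e i x, Finset.mul_sum]
  rw [hexp x w, hexp w x, Finset.sum_comm]
  exact Finset.sum_congr rfl fun j _ => Finset.sum_congr rfl fun i _ => by rw [hs i j]; ring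

/-- The Euler–Lagrange equation for `β` along the spray: contract `δ_k b_i = δ_i b_k` with `y^k`. -/
theorem contraction_spray (hb : IsGradientHVector D L b ρ) (h : IsFundamental D L)
    (hz : z ∈ D) (w : Coord n) :
    d2 (contraction b) z (z.2, (-2 : ℝ) • sprayVec L z) (0, w)
      = fderiv ℝ (contraction b) z (w, 0) := by
  have h1 := hb.gradient_horizontal h hz z.2 w
  have h2 := hb.fderiv_contraction h hz (w, -fderiv ℝ (sprayVec L) z (0, w))
  have h3 := hb.fderiv_contraction_vert h hz (-fderiv ℝ (sprayVec L) z (0, w))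
  rw [h.isSpray.fderiv_spray_self hz, ← neg_smul] at h1
  rw [pair_eq, map_add] at h2
  rw [hb.d2_contraction h hz, h1]
  rw [← pair_eq] at h2
  simp only at h2
  linarith

theorem isGradientChange (hb : IsGradientHVector D L b ρ) (h : IsFundamental D L)
    (h' : IsFundamental D L')
    (hL' : ∀ z, L' z = L z * Real.exp (contraction b z / L z)) :
    IsGradientChange D L (contraction b) (sprayVec L) (sprayVec L') where
  smoothL _ hz := h.contDiffAt hz
  smooth _ hz := hb.smooth_contraction h hz
  pos := h.pos
  spray := h.isSpray
  spray' := by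
    rw [← energy_expChange hL']
    exact h'.isSpray
  gradient _ hz := hb.contraction_spray h hz

end IsGradientHVector

end HVector

section Normal

variable {n : ℕ} {D : Set (Coord (n + 1) × Coord (n + 1))}
  {L L' : Coord (n + 1) × Coord (n + 1) → ℝ} {p : Coord n → Coord (n + 1)}

/-- The matrix whose rows below the zeroth one are the tangent vectors `B_α`. -/
noncomputable def tangentMatrix (p : Coord n → Coord (n + 1)) (u : Coord n) :
    Matrix (Fin (n + 1)) (Fin (n + 1)) ℝ :=
  Matrix.of (Fin.cons 0 fun a j => proj p j a u)

/-- A normal field in terms of cofactors: `g(N, w)` is the determinant of the matrix with rows `w`,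
`B_1`, …, `B_n`. -/
noncomputable def normalField (L : Coord (n + 1) × Coord (n + 1) → ℝ) (p : Coord n → Coord (n + 1))
    (q : Coord n × Coord n) : Coord (n + 1) :=
  WithLp.toLp 2 fun i =>
    ∑ j, metricInv L (tangentLift p q) i j * (tangentMatrix p q.1).adjugate j 0

theorem metric_normalField (h : IsFundamental D L) {q : Coord n × Coord n}
    (hz : tangentLift p q ∈ D) (w : Coord (n + 1)) :
    d2 (energy L) (tangentLift p q) (0, normalField L p q) (0, w)
      = ((tangentMatrix p q.1).updateRow 0 w).det := by
  rw [← Matrix.cramer_transpose_apply, Matrix.cramer_eq_adjugate_mulVec, Matrix.mulVec, dotProduct,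
    vert_expand _ w]
  refine Finset.sum_congr rfl fun i _ => ?_
  rw [d2_symm (h.contDiffAt_energy hz), vert_expand]
  have := h.sum_metric_mul_inv hz (fun l => if l = i then 1 else 0)
    (fun j => (tangentMatrix p q.1).adjugate j 0)
  simp only [mul_ite, mul_one, mul_zero, Finset.sum_ite_eq', Finset.mem_univ,
    if_true, ite_mul, one_mul, zero_mul] at this
  have e : (tangentMatrix p q.1).transpose.adjugate 0 i = (tangentMatrix p q.1).adjugate i 0 := by
    rw [← Matrix.adjugate_transpose, Matrix.transpose_apply]
  change _ = (tangentMatrix p q.1).transpose.adjugate 0 i * w i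
  rw [e, ← this, smul_eq_mul, mul_comm]
  congr 1
  refine Finset.sum_congr rfl fun j _ => ?_
  rw [← h.metric_eq hz, h.metric_symm hz, smul_eq_mul, mul_comm]
  rfl

theorem smooth_tangentLift {q : Coord n × Coord n} (hp : ContDiffAt ℝ ∞ p q.1) :
    ContDiffAt ℝ ∞ (tangentLift p) q :=
  (hp.comp q contDiffAt_fst).prodMk
    (((smooth_fderiv hp).comp q contDiffAt_fst).clm_apply contDiffAt_snd)

theorem smooth_normalField (h : IsFundamental D L) {q : Coord n × Coord n}
    (hz : tangentLift p q ∈ D) (hp : ContDiffAt ℝ ∞ p q.1) :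
    ContDiffAt ℝ ∞ (normalField L p) q := by
  rw [contDiffAt_euclidean]
  intro i
  have h1 : ∀ i j, ContDiffAt ℝ ∞ (fun q => metricInv L (tangentLift p q) i j) q := fun i j =>
    ContDiffAt.comp (g := fun z => metricInv L z i j) q
      (smooth_inv (fun i j => h.smooth_metric hz i j) (h.regular _ hz) i j) (smooth_tangentLift hp)
  have h2 : ∀ i j, ContDiffAt ℝ ∞ (fun q : Coord n × Coord n => tangentMatrix p q.1 i j) q :=
    fun i j => by
      refine Fin.cases ?_ (fun a => ?_) i
      · exact contDiffAt_const
      · exact ContDiffAt.comp (g := fun u => fderiv ℝ p u (basisVec a) j) q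
          ((EuclideanSpace.proj (𝕜 := ℝ) j).contDiff.contDiffAt.comp q.1
            ((smooth_fderiv hp).clm_apply contDiffAt_const)) contDiffAt_fst
  change ContDiffAt ℝ ∞ (fun q : Coord n × Coord n => ∑ j, metricInv L (tangentLift p q) i j *
    (tangentMatrix p q.1).adjugate j 0) q
  exact ContDiffAt.sum fun j _ => (h1 i j).mul (smooth_adjugate h2 j 0)

/-- A unit normal spans a complement of the tangent space. -/
theorem unitNormal_decompose {q : Coord n × Coord n} (hinj : Function.Injective (fderiv ℝ p q.1)) {N : Coord (n + 1)}
    (horth : ∀ a, d2 (energy L) (tangentLift p q) (0, N) (0, fderiv ℝ p q.1 a) = 0)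
    (hunit : d2 (energy L) (tangentLift p q) (0, N) (0, N) = 1) :
    (∀ (c : ℝ) s, c • N + fderiv ℝ p q.1 s = 0 → c = 0 ∧ s = 0) ∧
      ∀ w, ∃ (c : ℝ) (s : Coord n), w = c • N + fderiv ℝ p q.1 s := by
  have hker : ∀ (c : ℝ) s, c • N + fderiv ℝ p q.1 s = 0 → c = 0 ∧ s = 0 := fun c s hcs => by
    have h1 : d2 (energy L) (tangentLift p q) (0, N) (0, c • N + fderiv ℝ p q.1 s) = c := by
      rw [vert_add, vert_smul, map_add, map_smul, hunit, horth]
      simp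
    have e0 : ((0 : Coord (n + 1)), (0 : Coord (n + 1))) = 0 := rfl
    rw [hcs, e0, map_zero] at h1
    subst h1
    rw [zero_smul, zero_add] at hcs
    exact ⟨rfl, hinj (hcs.trans (map_zero _).symm)⟩
  refine ⟨hker, fun w => ?_⟩
  let Φ : ℝ × Coord n →ₗ[ℝ] Coord (n + 1) :=
    (LinearMap.toSpanSingleton ℝ (Coord (n + 1)) N).coprod (fderiv ℝ p q.1).toLinearMap
  have hΦ : Function.Injective Φ := by
    rw [← LinearMap.ker_eq_bot, LinearMap.ker_eq_bot']
    rintro ⟨c, s⟩ hcs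
    obtain ⟨h1, h2⟩ := hker c s hcs
    rw [h1, h2]
    rfl
  have hdim : Module.finrank ℝ (ℝ × Coord n) = Module.finrank ℝ (Coord (n + 1)) := by
    simp [add_comm]
  obtain ⟨⟨c, s⟩, hcs⟩ := (LinearMap.injective_iff_surjective_of_finrank_eq_finrank hdim).1 hΦ w
  exact ⟨c, s, hcs.symm⟩

theorem det_tangentMatrix_ne_zero {q : Coord n × Coord n} {N : Coord (n + 1)}
    (hN : ∀ (c : ℝ) s, c • N + fderiv ℝ p q.1 s = 0 → c = 0 ∧ s = 0) :
    ((tangentMatrix p q.1).updateRow 0 N).det ≠ 0 := fun h0 => by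
  obtain ⟨x, hx, hx0⟩ := Matrix.exists_vecMul_eq_zero_iff.2 h0
  have h1 : x 0 • N + fderiv ℝ p q.1 (WithLp.toLp 2 fun a => x a.succ) = 0 := by
    ext j
    have h2 := congrFun hx0 j
    rw [Matrix.vecMul, dotProduct, Fin.sum_univ_succ, Matrix.updateRow_self] at h2
    rw [linear_expand (fderiv ℝ p q.1)]
    simpa [Matrix.updateRow_ne, tangentMatrix, proj, Fin.succ_ne_zero] using h2
  obtain ⟨hc, hs⟩ := hN _ _ h1
  refine hx (funext fun i => Fin.cases hc (fun a => ?_) i)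
  exact congrArg (fun s : Coord n => s a) hs

/-- The admissible supporting elements of a parametrized hypersurface over a set `W` of
parameters. -/
def admissible (D : Set (Coord (n + 1) × Coord (n + 1))) (p : Coord n → Coord (n + 1))
    (W : Set (Coord n)) : Set (Coord n × Coord n) :=
  {q | q.1 ∈ W ∧ tangentLift p q ∈ D}

theorem tangent_eq_zero {q : Coord n × Coord n} (A : Coord (n + 1) × Coord (n + 1) →L[ℝ] ℝ)
    (hA : ∀ a, A (0, fderiv ℝ p q.1 (basisVec a)) = 0) (s : Coord n) :
    A (0, fderiv ℝ p q.1 s) = 0 := by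
  have := linear_expand ((A.comp (ContinuousLinearMap.inr ℝ _ _)).comp (fderiv ℝ p q.1)) s
  simp only [ContinuousLinearMap.comp_apply, ContinuousLinearMap.inr_apply, hA] at this
  simpa using this

theorem isNormalField_normalField (h : IsFundamental D L) {W : Set (Coord n)} (hW : IsOpen W)
    (hp : ∀ u ∈ W, ContDiffAt ℝ ∞ p u) (hinj : ∀ u ∈ W, Function.Injective (fderiv ℝ p u))
    (hunit : ∀ u ∈ W, ∀ v, lift p u v ∈ D → ∃ N, IsUnitNormal L p u v N) :
    IsNormalField D (energy L) (admissible D p W) p (normalField L p) := by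
  have horth : ∀ q ∈ admissible D p W, ∀ a, d2 (energy L) (tangentLift p q)
      (0, normalField L p q) (0, fderiv ℝ p q.1 a) = 0 := fun q hq => by
    refine tangent_eq_zero _ fun a => ?_
    rw [metric_normalField h hq.2]
    refine Matrix.det_zero_of_row_eq (Fin.succ_ne_zero a).symm ?_
    rw [Matrix.updateRow_self, Matrix.updateRow_ne (Fin.succ_ne_zero a)]
    rfl
  have hdec : ∀ q ∈ admissible D p W, ∃ N,
      (∀ s, d2 (energy L) (tangentLift p q) (0, N) (0, fderiv ℝ p q.1 s) = 0) ∧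
      d2 (energy L) (tangentLift p q) (0, normalField L p q) (0, N) ≠ 0 ∧
      ∀ w, ∃ (c : ℝ) (s : Coord n), w = c • N + fderiv ℝ p q.1 s := fun q hq => by
    obtain ⟨N, hN⟩ := hunit q.1 hq.1 q.2 hq.2
    obtain ⟨h1, h2⟩ := (h.isUnitNormal_iff hq.2).1 hN
    have h3 := tangent_eq_zero (q := q) _ h1
    obtain ⟨h4, h5⟩ := unitNormal_decompose (hinj q.1 hq.1) h3 h2
    refine ⟨_, h3, ?_, h5⟩
    rw [metric_normalField h hq.2]
    exact det_tangentMatrix_ne_zero h4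
  refine ⟨?_, fun q hq => hp _ hq.1, fun q hq => hq.2,
    fun q hq => smooth_normalField h hq.2 (hp _ hq.1), horth, ?_, ?_⟩
  · refine isOpen_iff_mem_nhds.2 fun q hq => ?_
    exact Filter.inter_mem (continuous_fst.continuousAt (hW.mem_nhds hq.1))
      ((smooth_tangentLift (hp _ hq.1)).continuousAt (h.isOpen.mem_nhds hq.2))
  · intro q hq h0
    obtain ⟨N, -, h2, -⟩ := hdec q hq
    have e0 : ((0 : Coord (n + 1)), (0 : Coord (n + 1))) = 0 := rfl
    rw [h0, e0] at h2
    simp at h2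
  · intro q hq w
    obtain ⟨N, h1, h2, h3⟩ := hdec q hq
    obtain ⟨c, s, rfl⟩ := h3 w
    obtain ⟨c₀, s₀, h4⟩ := h3 (normalField L p q)
    have hc₀ : c₀ ≠ 0 := fun h0 => h2 (by
      rw [h4, h0, zero_smul, zero_add, d2_symm (h.contDiffAt_energy hq.2), h1])
    refine ⟨c / c₀, s - (c / c₀) • s₀, ?_⟩
    rw [h4, smul_add, smul_smul, div_mul_cancel₀ _ hc₀, map_sub, map_smul]
    abel

theorem bilinear_eq_zero {f : Coord n → Coord n → ℝ} (hl : ∀ y, IsLinearMap ℝ fun x => f x y)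
    (hr : ∀ x, IsLinearMap ℝ (f x)) (h0 : ∀ i j, f (basisVec i) (basisVec j) = 0)
    (x y : Coord n) : f x y = 0 := by
  have h1 : ∀ j x, f x (basisVec j) = 0 := fun j x => by
    change (hl (basisVec j)).mk' _ x = 0
    rw [coord_eq_sum x, map_sum]
    exact Finset.sum_eq_zero fun i _ => by rw [map_smul, IsLinearMap.mk'_apply, h0, smul_zero]
  change (hr x).mk' _ y = 0
  rw [coord_eq_sum y, map_sum]
  exact Finset.sum_eq_zero fun i _ => by rw [map_smul, IsLinearMap.mk'_apply, h1, smul_zero]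

/-- The tensor `H_αβ` is determined by its components, for normals of any length. -/
theorem curvature_of_basis {G : Coord (n + 1) × Coord (n + 1) → Coord (n + 1)}
    {E : Coord (n + 1) × Coord (n + 1) → ℝ} {T : Set (Coord n × Coord n)}
    {N : Coord n × Coord n → Coord (n + 1)} (hN : IsNormalField D E T p N) (h : IsSpray D E G)
    {q : Coord n × Coord n} (hq : q ∈ T) (c : ℝ)
    (h0 : ∀ a b, IsNormalField.curvatureTensor E G p N q (basisVec a) (basisVec b)
      + c * d3 E (tangentLift p q) (0, fderiv ℝ p q.1 (basisVec a)) (0, N q) (0, N q)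
        * IsNormalField.curvatureVec E G p N q (basisVec b) = 0) (x y : Coord n) :
    IsNormalField.curvatureTensor E G p N q x y
      + c * d3 E (tangentLift p q) (0, fderiv ℝ p q.1 x) (0, N q) (0, N q)
        * IsNormalField.curvatureVec E G p N q y = 0 := by
  refine bilinear_eq_zero (f := fun x y => IsNormalField.curvatureTensor E G p N q x y
      + c * d3 E (tangentLift p q) (0, fderiv ℝ p q.1 x) (0, N q) (0, N q)
        * IsNormalField.curvatureVec E G p N q y) (fun y => ⟨fun u v => ?_, fun r u => ?_⟩)
    (fun x => ⟨fun u v => ?_, fun r u => ?_⟩) h0 x y <;>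
  · simp only [hN.curvatureTensor_eq h hq, IsNormalField.curvatureVec, landsberg, map_add, map_smul,
      vert_add, vert_smul, add_apply, smul_apply, smul_eq_mul]
    ring

theorem curvatureTensor_smul (E : Coord (n + 1) × Coord (n + 1) → ℝ)
    (G : Coord (n + 1) × Coord (n + 1) → Coord (n + 1)) (N : Coord n × Coord n → Coord (n + 1))
    (q : Coord n × Coord n) (c : ℝ) (x y : Coord n) :
    IsNormalField.curvatureTensor E G p (fun _ => c • N q) q x y
      = c * IsNormalField.curvatureTensor E G p N q x y := by
  have e : (c • N q, -fderiv ℝ G (tangentLift p q) (0, c • N q))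
      = c • (N q, -fderiv ℝ G (tangentLift p q) (0, N q)) := by
    rw [vert_smul, map_smul, Prod.smul_mk, smul_neg]
  simp only [IsNormalField.curvatureTensor, e]
  simp only [vert_smul, map_smul, smul_apply, smul_eq_mul]
  ring

/-- The third kind of hyperplane is preserved, in coordinates; `W` is the domain of the
parametrization `p`. -/
theorem hyperplane_coordinates (h : IsFundamental D L) (h' : IsFundamental D L')
    {b : Fin (n + 1) → Coord (n + 1) × Coord (n + 1) → ℝ}
    {ρ : Coord (n + 1) × Coord (n + 1) → ℝ} (hb : IsGradientHVector D L b ρ)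
    (hL' : ∀ z, L' z = L z * Real.exp (contraction b z / L z))
    {W : Set (Coord n)} (hW : IsOpen W)
    (hp : ∀ u ∈ W, ContDiffAt ℝ ∞ p u) (hinj : ∀ u ∈ W, Function.Injective (fderiv ℝ p u))
    (hunit : ∀ u ∈ W, ∀ v, lift p u v ∈ D → ∃ N, IsUnitNormal L p u v N)
    (htan : ∀ u ∈ W, ∀ v, lift p u v ∈ D → ∀ N, IsUnitNormal L p u v N →
      ∑ j, b j (lift p u v) * N j = 0)
    (hH : ∀ u ∈ W, ∀ v, lift p u v ∈ D → ∀ N, IsUnitNormal L p u v N →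
      ∀ a b, tenH L p u v N a b = 0 ∧ tenM L p u v N a b = 0) :
    ∀ u ∈ W, ∀ v, lift p u v ∈ D → ∀ N, IsUnitNormal L' p u v N →
      ∀ a b, tenH L' p u v N a b = 0 ∧ tenM L' p u v N a b = 0 := by
  have hN := isNormalField_normalField h hW hp hinj hunit
  set T := admissible D p W
  set Nf := normalField L p
  have hch := hb.isGradientChange h h' hL'
  -- A unit normal is a nonzero multiple of the normal field.
  have hmul : ∀ q ∈ T, ∃ (N : Fin (n + 1) → ℝ) (c : ℝ), IsUnitNormal L p q.1 q.2 N ∧ c ≠ 0 ∧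
      WithLp.toLp 2 N = c • Nf q := fun q hq => by
    obtain ⟨N, hNu⟩ := hunit q.1 hq.1 q.2 hq.2
    obtain ⟨h1, h2⟩ := (h.isUnitNormal_iff hq.2).1 hNu
    obtain ⟨c, hc⟩ := hN.normal_of_metric h.isSpray hq (tangent_eq_zero (q := q) _ h1)
    refine ⟨N, c, hNu, fun h0 => ?_, hc⟩
    have e0 : ((0 : Coord (n + 1)), (0 : Coord (n + 1))) = 0 := rfl
    rw [hc, h0, zero_smul, e0] at h2
    simp at h2
  have hβ : ∀ q ∈ T, fderiv ℝ (contraction b) (tangentLift p q) (0, Nf q) = 0 := fun q hq => by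
    obtain ⟨N, c, hNu, hc, hNc⟩ := hmul q hq
    have h1 : fderiv ℝ (contraction b) (tangentLift p q) (0, c • Nf q) = 0 := by
      rw [← hNc, hb.fderiv_contraction_vert h hq.2]
      exact htan q.1 hq.1 q.2 hq.2 N hNu
    rw [vert_smul, map_smul, smul_eq_mul] at h1
    exact (mul_eq_zero.1 h1).resolve_left hc
  have hβ2 : ∀ q ∈ T, ∀ a,
      d2 (contraction b) (tangentLift p q) (0, Nf q) (0, fderiv ℝ p q.1 a) = 0 := fun q hq a => by
    rw [d2_symm (hb.smooth_contraction h hq.2), hb.d2_contraction h hq.2]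
    have h1 : ∀ i, fderiv ℝ (b i) (tangentLift p q) (0, fderiv ℝ p q.1 a)
        = ρ (tangentLift p q) / L (tangentLift p q) *
          (d2 (energy L) (tangentLift p q) (0, fderiv ℝ p q.1 a) (0, basisVec i)
            - fderiv ℝ L (tangentLift p q) (0, basisVec i)
              * fderiv ℝ L (tangentLift p q) (0, fderiv ℝ p q.1 a)) :=
      fun i => hb.fderiv_vert h hq.2 i _
    calc _ = ρ (tangentLift p q) / L (tangentLift p q) *
          (d2 (energy L) (tangentLift p q) (0, fderiv ℝ p q.1 a) (0, Nf q)
            - fderiv ℝ L (tangentLift p q) (0, Nf q)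
              * fderiv ℝ L (tangentLift p q) (0, fderiv ℝ p q.1 a)) := by
          rw [vert_expand _ (Nf q), vert_expand _ (Nf q), Finset.sum_mul,
            ← Finset.sum_sub_distrib, Finset.mul_sum]
          refine Finset.sum_congr rfl fun i _ => ?_
          rw [h1]
          simp only [smul_eq_mul]
          ring
      _ = 0 := by
          rw [d2_symm (h.contDiffAt_energy hq.2), hN.orthogonal q hq, hch.fderiv_L_normal hN hq]
          simp
  have hM : HasZeroCartan (energy L) T p Nf := fun q hq x y => by
    obtain ⟨N, c, hNu, hc, hNc⟩ := hmul q hq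
    have hE := h.contDiffAt_energy hq.2
    have key : ∀ i j, d3 (energy L) (tangentLift p q) (0, Nf q)
        (0, fderiv ℝ p q.1 (basisVec i)) (0, fderiv ℝ p q.1 (basisVec j)) = 0 := fun i j => by
      have h1 := (hH q.1 hq.1 q.2 hq.2 N hNu i j).2
      rw [h.tenM_eq hq.2, hNc, vert_smul, map_smul, smul_eq_mul] at h1
      rw [d3_symm_left hE, d3_symm_right hE]
      simpa [hc] using h1
    rw [d3_symm_right hE, d3_symm_left hE]
    refine tangent_eq_zero (q := q) _ (fun j => ?_) y
    have := tangent_eq_zero (q := q) ((d3 (energy L) (tangentLift p q) (0, Nf q)).flip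
      (0, fderiv ℝ p q.1 (basisVec j))) (fun i => key i j) x
    exact this
  have hcurv : ∀ q ∈ T, ∃ c : ℝ, ∀ x y,
      IsNormalField.curvatureTensor (energy L) (sprayVec L) p Nf q x y
        + c * d3 (energy L) (tangentLift p q) (0, fderiv ℝ p q.1 x) (0, Nf q) (0, Nf q)
          * IsNormalField.curvatureVec (energy L) (sprayVec L) p Nf q y = 0 := fun q hq => by
    obtain ⟨N, c, hNu, hc, hNc⟩ := hmul q hq
    refine ⟨c ^ 2 / 2, curvature_of_basis hN h.isSpray hq _ fun i j => ?_⟩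
    have h1 := (hH q.1 hq.1 q.2 hq.2 N hNu i j).1
    rw [h.tenH_eq hq.2 (hp _ hq.1), h.vecM_eq hq.2, h.vecH_eq hq.2 (hp _ hq.1), hNc,
      curvatureTensor_smul] at h1
    simp only [vert_smul, map_smul, smul_apply, smul_eq_mul] at h1
    refine mul_left_cancel₀ hc ?_
    rw [mul_zero, ← h1, IsNormalField.curvatureVec]
    ring
  obtain ⟨ht, hl⟩ := hN.of_curvature_eq_zero h.isSpray hcurv
  obtain ⟨ht', hl', hM'⟩ := hch.hyperplane hN hβ hβ2 ht hl hM
  have hN' := hch.isNormalField hN hβ hβ2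
  rw [← energy_expChange hL'] at hl' hM' hN'
  intro u hu v hz N hNu a b
  have hq : (u, v) ∈ T := ⟨hu, hz⟩
  obtain ⟨h1, h2⟩ := (h'.isUnitNormal_iff hz).1 hNu
  obtain ⟨c, hc⟩ := hN'.normal_of_metric h'.isSpray hq (tangent_eq_zero (q := (u, v)) _ h1)
  constructor
  · rw [h'.tenH_eq hz (hp u hu), h'.vecH_eq hz (hp u hu), hc,
      curvatureTensor_smul, hN'.curvatureTensor_eq_zero h'.isSpray ht' hl' hq, vert_smul, map_smul,
      smul_apply]
    have := hN'.curvatureVec_eq_zero ht' hq (basisVec b)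
    rw [IsNormalField.curvatureVec] at this
    rw [this]
    simp
  · rw [h'.tenM_eq hz, hc, vert_smul, map_smul]
    have := hM' _ hq (basisVec a) (basisVec b)
    rw [this]
    simp

end Normal

/-! ### Charts -/

section Charts

theorem localFun_expChange {n : ℕ} {M : Type*} [TopologicalSpace M] [ChartedSpace (Coord n) M]
    (L : TangentBundle (Mod n) M → ℝ)
    (b : (w : TangentBundle (Mod n) M) → TangentSpace (Mod n) w.proj →L[ℝ] ℝ)
    (φ : OpenPartialHomeomorph M (Coord n)) (z : Coord n × Coord n) :
    localFun (expChange L b) φ z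
      = localFun L φ z * Real.exp (contraction (localCovec b φ) z / localFun L φ z) := by
  have h1 : b (vecOf φ z) (vecOf φ z).snd = contraction (localCovec b φ) z := by
    let A : Coord n →L[ℝ] ℝ := (b (vecOf φ z)).comp (mfderiv (Mod n) (Mod n) φ.symm z.1)
    exact (linear_expand A z.2).trans (Finset.sum_congr rfl fun i _ => mul_comm _ _)
  rw [localFun, expChange, h1]
  rfl

variable {m : ℕ} {M : Type*} [TopologicalSpace M] {S : Type*} [TopologicalSpace S]

/-- The domain of the coordinate expression of `ι : S → M`. -/
def paramDomain (ι : S → M) (φ : OpenPartialHomeomorph M (Coord (m + 1)))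
    (ψ : OpenPartialHomeomorph S (Coord m)) : Set (Coord m) :=
  ψ.target ∩ ψ.symm ⁻¹' (ι ⁻¹' φ.source)

theorem isOpen_paramDomain {ι : S → M} (hι : Continuous ι)
    (φ : OpenPartialHomeomorph M (Coord (m + 1))) (ψ : OpenPartialHomeomorph S (Coord m)) :
    IsOpen (paramDomain ι φ ψ) :=
  ψ.isOpen_inter_preimage_symm (φ.open_source.preimage hι)

theorem mdifferentiable_of_mem_maximalAtlas {n : ℕ} {M : Type*} [TopologicalSpace M]
    [ChartedSpace (Coord n) M] [IsManifold (Mod n) ∞ M] {φ : OpenPartialHomeomorph M (Coord n)}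
    (hφ : φ ∈ IsManifold.maximalAtlas (Mod n) ∞ M) : φ.MDifferentiable (Mod n) (Mod n) :=
  ⟨(contMDiffOn_of_mem_maximalAtlas hφ).mdifferentiableOn (by simp),
    (contMDiffOn_symm_of_mem_maximalAtlas hφ).mdifferentiableOn (by simp)⟩

variable [ChartedSpace (Coord (m + 1)) M] [ChartedSpace (Coord m) S]

theorem smooth_param {ι : S → M} (hι : ContMDiff (Mod m) (Mod (m + 1)) ∞ ι)
    {φ : OpenPartialHomeomorph M (Coord (m + 1))} {ψ : OpenPartialHomeomorph S (Coord m)}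
    (hφ : φ ∈ IsManifold.maximalAtlas (Mod (m + 1)) ∞ M)
    (hψ : ψ ∈ IsManifold.maximalAtlas (Mod m) ∞ S) {u : Coord m} (hu : u ∈ paramDomain ι φ ψ) :
    ContDiffAt ℝ ∞ (param ι φ ψ) u := by
  rw [← contMDiffAt_iff_contDiffAt]
  have h1 := (contMDiffOn_symm_of_mem_maximalAtlas hψ).contMDiffAt (ψ.open_target.mem_nhds hu.1)
  have h2 := (contMDiffOn_of_mem_maximalAtlas hφ).contMDiffAt (φ.open_source.mem_nhds hu.2)
  exact h2.comp u (hι.contMDiffAt.comp u h1)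

theorem injective_fderiv_param [IsManifold (Mod (m + 1)) ∞ M] [IsManifold (Mod m) ∞ S] {ι : S → M} (hι : ContMDiff (Mod m) (Mod (m + 1)) ∞ ι)
    (hinj : ∀ s, Function.Injective (mfderiv (Mod m) (Mod (m + 1)) ι s))
    {φ : OpenPartialHomeomorph M (Coord (m + 1))} {ψ : OpenPartialHomeomorph S (Coord m)}
    (hφ : φ ∈ IsManifold.maximalAtlas (Mod (m + 1)) ∞ M)
    (hψ : ψ ∈ IsManifold.maximalAtlas (Mod m) ∞ S) {u : Coord m} (hu : u ∈ paramDomain ι φ ψ) :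
    Function.Injective (fderiv ℝ (param ι φ ψ) u) := by
  have h1 := mdifferentiable_of_mem_maximalAtlas hφ
  have h2 := mdifferentiable_of_mem_maximalAtlas hψ
  have d1 := h2.mdifferentiableAt_symm hu.1
  have d2 := (hι.mdifferentiable (by simp)) (ψ.symm u)
  have d3 := h1.mdifferentiableAt hu.2
  have e1 : mfderiv (Mod m) (Mod (m + 1)) (param ι φ ψ) u
      = (mfderiv (Mod (m + 1)) (Mod (m + 1)) φ (ι (ψ.symm u))).comp
        ((mfderiv (Mod m) (Mod (m + 1)) ι (ψ.symm u)).comp (mfderiv (Mod m) (Mod m) ψ.symm u)) :=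
    (mfderiv_comp u d3 (d2.comp u d1)).trans (congrArg _ (mfderiv_comp u d2 d1))
  rw [← mfderiv_eq_fderiv, e1]
  exact (h1.mfderiv_injective hu.2).comp ((hinj _).comp (h2.symm.mfderiv_injective hu.1))

end Charts

end Finsler

theorem theorem4p3 {n : ℕ}
    {M : Type*} [TopologicalSpace M] [ChartedSpace (Finsler.Coord (n + 1)) M]
    [IsManifold (Finsler.Mod (n + 1)) ∞ M]
    {S : Type*} [TopologicalSpace S] [ChartedSpace (Finsler.Coord n) S]
    [IsManifold (Finsler.Mod n) ∞ S]
    (D : Set (TangentBundle (Finsler.Mod (n + 1)) M))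
    (L : TangentBundle (Finsler.Mod (n + 1)) M → ℝ)
    (b : (w : TangentBundle (Finsler.Mod (n + 1)) M) →
      TangentSpace (Finsler.Mod (n + 1)) w.proj →L[ℝ] ℝ)
    (ι : S → M)
    (hF : Finsler.IsFinslerSpace D L)
    (hF' : Finsler.IsFinslerSpace D (Finsler.expChange L b))
    (hb : Finsler.IsHVector D L b)
    (hS : Finsler.IsFinslerHypersurface D L ι)
    (hS' : Finsler.IsFinslerHypersurface D (Finsler.expChange L b) ι)
    (hgrad : Finsler.IsGradient D L b)
    (htan : Finsler.IsTangential D L b ι)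
    (hkappa : Finsler.HasKappa D L b) :
    (Finsler.IsHyperplaneSecondKind D L ι → Finsler.VanishingM D L ι →
      Finsler.IsHyperplaneSecondKind D (Finsler.expChange L b) ι) ∧
    (Finsler.IsHyperplaneThirdKind D L ι →
      Finsler.IsHyperplaneThirdKind D (Finsler.expChange L b) ι) := by
  have key : Finsler.IsHyperplaneThirdKind D L ι →
      Finsler.IsHyperplaneThirdKind D (Finsler.expChange L b) ι := by
    intro hH φ hφ ψ hψ u hu hιu v hz N hN
    obtain ⟨ρ, -, hρ⟩ := hb
    have hbl : Finsler.IsGradientHVector (Finsler.localDom D φ) (Finsler.localFun L φ)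
        (Finsler.localCovec b φ) (Finsler.localFun ρ φ) :=
      ⟨(hρ φ hφ).1, fun z hz i j => ((hρ φ hφ).2 z hz i j).1,
        fun z hz i j => ((hρ φ hφ).2 z hz i j).2, hgrad φ hφ⟩
    exact Finsler.hyperplane_coordinates (hF φ hφ) (hF' φ hφ) hbl
      (Finsler.localFun_expChange L b φ)
      (Finsler.isOpen_paramDomain hS.smooth.continuous φ ψ)
      (fun u hu => Finsler.smooth_param hS.smooth hφ hψ hu)
      (fun u hu => Finsler.injective_fderiv_param hS.smooth hS.immersion hφ hψ hu)
      (fun u hu v hz => hS.unitNormal φ hφ ψ hψ u hu.1 hu.2 v hz)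
      (fun u hu v hz N hN => htan φ hφ ψ hψ u hu.1 hu.2 v hz N hN)
      (fun u hu v hz N hN => hH φ hφ ψ hψ u hu.1 hu.2 v hz N hN) u ⟨hu, hιu⟩ v hz N hN
  refine ⟨fun hH hM φ hφ ψ hψ u hu hιu v hz N hN a c => ?_, key⟩
  exact (key (fun φ hφ ψ hψ u hu hιu v hz N hN a c =>
    ⟨hH φ hφ ψ hψ u hu hιu v hz N hN a c, hM φ hφ ψ hψ u hu hιu v hz N hN a c⟩)
    φ hφ ψ hψ u hu hιu v hz N hN a c).1
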